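/- Let $D=(0,1)$ and $\alpha\in(3/2,2)$. For $0<s<1$ let $\widetilde H^{s}_L(D)$ be the space of real functions $u\in L^2(D)$ whose extension by zero $\tilde u$ belongs to the Sobolev space $H^{s}(-\infty,1)$, with norm $\|u\|_{\widetilde H^{s}_L(D)}=\|\tilde u\|_{H^{s}(-\infty,1)}$, where $$\|f\|_{H^s(-\infty,1)}^2=\int_{-\infty}^1|f(x)|^2\,dx+\int_{-\infty}^1\!\int_{-\infty}^1\frac{|f(x)-f(y)|^2}{|x-y|^{1+2s}}\,dx\,dy .$$ For $0<\beta<1$ let ${}_0^RD_x^{\beta}u=\frac{d}{dx}\,{}_0I_x^{1-\beta}u$ be the left-sided Riemann--Liouville derivative on $D$, where $({}_0I_x^{\gamma}u)(x)=\frac1{\Gamma(\gamma)}\int_0^x(x-t)^{\gamma-1}u(t)\,dt$ and $\frac{d}{dx}$ is the weak derivative. Let $$U=\bigl(\widetilde H_L^{\alpha-1}(D)\oplus \mathrm{span}\{x^{\alpha-2}\}\bigr)\cap\{u:\ u(1)=0\},$$ where values at $1$ are those of the representative that is continuous on $(0,1]$. Then every $u\in U$ can be written as $u=u_0-u_0(1)\,x^{\alpha-2}$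 with a unique $u_0\in\widetilde H_L^{\alpha-1}(D)$; every $\varphi\in \widetilde H_L^{\alpha-1}(D)$ has a unique derivative ${}_0^RD_x^{\alpha-1}\varphi\in L^2(D)$; and there are constants $c,C>0$, depending only on $\alpha$, such that $$c\,\|\varphi\|_{\widetilde H_L^{\alpha-1}(D)}\le\|{}_0^RD_x^{\alpha-1}\varphi\|_{L^2(D)}\le C\,\|\varphi\|_{\widetilde H_L^{\alpha-1}(D)}\qquad\text{for all }\varphi\in\widetilde H_L^{\alpha-1}(D).$$ Moreover, the functional $\|u\|_U=\|{}_0^RD_x^{\alpha-1}u_0\|_{L^2(D)}$ is a norm on $U$, and $U$ with this norm is a Banach space. -/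

import Mathlib

open MeasureTheory Set

namespace FracMixed

noncomputable section

/-- Lebesgue measure on the unit interval `D = (0,1)`. -/
abbrev volD : Measure ℝ := volume.restrict (Ioo (0 : ℝ) 1)

/-- The real space `L²(D)`. -/
abbrev L2D : Type := Lp ℝ 2 volD

/-- Extension by zero of a function on `D = (0,1)` to the real line. -/
def zeroExt (u : ℝ → ℝ) : ℝ → ℝ := (Ioo (0 : ℝ) 1).indicator u

/-- The difference quotient `(f(x) - f(y)) / |x - y|^(1/2+s)`, whose `L²(J × J)` norm is the
Sobolev-Slobodeckij seminorm of order `s ∈ (0,1)` on `J`. -/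
def diffQuot (s : ℝ) (f : ℝ → ℝ) : ℝ × ℝ → ℝ :=
  fun p => (f p.1 - f p.2) / |p.1 - p.2| ^ (1 / 2 + s)

/-- `f ∈ H^s(J)`, for an interval `J` and `0 < s < 1` (Sobolev-Slobodeckij definition):
`f ∈ L²(J)` and `∬_{J×J} |f(x) - f(y)|² / |x - y|^(1+2s) dx dy < ∞`. -/
def MemHs (s : ℝ) (J : Set ℝ) (f : ℝ → ℝ) : Prop :=
  MemLp f 2 (volume.restrict J) ∧
    MemLp (diffQuot s f) 2 ((volume.restrict J).prod (volume.restrict J))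

/-- The `H^s(J)` norm
`(‖f‖²_{L²(J)} + ∬_{J×J} |f(x) - f(y)|² / |x - y|^(1+2s) dx dy)^(1/2)`, `0 < s < 1`. -/
def normHs (s : ℝ) (J : Set ℝ) (f : ℝ → ℝ) : ℝ :=
  Real.sqrt ((eLpNorm f 2 (volume.restrict J)).toReal ^ 2 +
    (eLpNorm (diffQuot s f) 2 ((volume.restrict J).prod (volume.restrict J))).toReal ^ 2)

theorem MemHs.add {s : ℝ} {J : Set ℝ} {f g : ℝ → ℝ} (hf : MemHs s J f) (hg : MemHs s J g) :
    MemHs s J (f + g) := by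
  refine ⟨hf.1.add hg.1, ?_⟩
  have h := hf.2.add hg.2
  have e : diffQuot s f + diffQuot s g = diffQuot s (f + g) := by
    funext p
    simp only [diffQuot, Pi.add_apply]
    ring
  rwa [e] at h

theorem MemHs.smul {s : ℝ} {J : Set ℝ} {f : ℝ → ℝ} (c : ℝ) (hf : MemHs s J f) :
    MemHs s J (c • f) := by
  refine ⟨hf.1.const_smul c, ?_⟩
  have h := hf.2.const_smul c
  have e : c • diffQuot s f = diffQuot s (c • f) := by
    funext p
    simp only [diffQuot, Pi.smul_apply, smul_eq_mul]
    ring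
  rwa [e] at h

theorem MemHs.congr {s : ℝ} {J : Set ℝ} {f g : ℝ → ℝ} (hf : MemHs s J f)
    (h : f =ᵐ[volume.restrict J] g) : MemHs s J g := by
  refine ⟨hf.1.ae_eq h, hf.2.ae_eq ?_⟩
  have h1 := Measure.quasiMeasurePreserving_fst (μ := volume.restrict J)
    (ν := volume.restrict J) |>.ae_eq_comp h
  have h2 := Measure.quasiMeasurePreserving_snd (μ := volume.restrict J)
    (ν := volume.restrict J) |>.ae_eq_comp h
  filter_upwards [h1, h2] with p hp1 hp2
  simp only [Function.comp_apply] at hp1 hp2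
  simp only [diffQuot, hp1, hp2]

theorem zeroExt_congr {u v : ℝ → ℝ} (h : u =ᵐ[volD] v) (J : Set ℝ) :
    zeroExt u =ᵐ[volume.restrict J] zeroExt v := by
  have h0 : zeroExt u =ᵐ[volume] zeroExt v := 
    (ae_eq_restrict_iff_indicator_ae_eq measurableSet_Ioo).1 h
  exact ae_restrict_of_ae h0

/-- The space of all functions `u` on `D` whose extension by zero lies in `H^s(-∞,1)`,
for `0 < s < 1`. -/
def HtildeL (s : ℝ) : Submodule ℝ L2D where
  carrier := {u | MemHs s (Iio 1) (zeroExt u)}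
  add_mem' := by
    intro u v hu hv
    have e : zeroExt u + zeroExt v = zeroExt (⇑u + ⇑v) := (indicator_add' _ _ _).symm
    have h := MemHs.add hu hv
    rw [e] at h
    exact h.congr (zeroExt_congr (Lp.coeFn_add u v).symm _)
  zero_mem' := by
    have h0 : MemHs s (Iio 1) (0 : ℝ → ℝ) := by
      refine ⟨MemLp.zero, ?_⟩
      have e : diffQuot s 0 = 0 := by
        funext p
        simp [diffQuot]
      rw [e]
      exact MemLp.zero
    have e : zeroExt (0 : ℝ → ℝ) = 0 := indicator_zero' _
    rw [← e] at h0
    exact h0.congr (zeroExt_congr (Lp.coeFn_zero ℝ 2 volD).symm _)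
  smul_mem' := by
    intro c u hu
    have e : c • zeroExt u = zeroExt (c • ⇑u) :=
      (indicator_const_smul (Ioo (0 : ℝ) 1) c (⇑u)).symm
    have h := MemHs.smul c hu
    rw [e] at h
    exact h.congr (zeroExt_congr (Lp.coeFn_smul c u).symm _)

/-- The norm of `HtildeL s`: the `H^s(-∞,1)` norm of the extension by zero. -/
def normHtildeL (s : ℝ) (u : L2D) : ℝ := normHs s (Iio 1) (zeroExt u)

/-- The left-sided Riemann-Liouville fractional integral of order `γ > 0`, based at `0`. -/
def rlIntegral (γ : ℝ) (f : ℝ → ℝ) (x : ℝ) : ℝ :=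
  1 / Real.Gamma γ * ∫ t in (0 : ℝ)..x, (x - t) ^ (γ - 1) * f t

/-- `g` is the weak derivative of `f` on `D = (0,1)`. -/
def HasWeakDeriv (f g : ℝ → ℝ) : Prop :=
  LocallyIntegrableOn f (Ioo 0 1) ∧ LocallyIntegrableOn g (Ioo 0 1) ∧
    ∀ ψ : ℝ → ℝ, ContDiff ℝ (⊤ : ℕ∞) ψ → HasCompactSupport ψ → tsupport ψ ⊆ Ioo 0 1 →
      ∫ x in Ioo (0 : ℝ) 1, f x * deriv ψ x = - ∫ x in Ioo (0 : ℝ) 1, g x * ψ x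

/-- `g ∈ L²(D)` is the left-sided Riemann-Liouville derivative of order `β ∈ (0,1)` of `u`:
the derivative, in the weak sense, of the fractional integral of order `1 - β` of `u`. -/
def IsRLDeriv (β : ℝ) (u g : L2D) : Prop := HasWeakDeriv (rlIntegral (1 - β) u) g

open Classical in
/-- The left-sided Riemann-Liouville derivative of order `β ∈ (0,1)` as an element of `L²(D)`
(zero if there is none). -/
def rlDeriv (β : ℝ) (u : L2D) : L2D := if h : ∃ g, IsRLDeriv β u g then h.choose else 0

/-- `u(1) = c`: the function `u` on `D` has a representative that is continuous on `(0,1]`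
and takes the value `c` at `1`. -/
def HasValueAtOne (u : ℝ → ℝ) (c : ℝ) : Prop :=
  ∃ f : ℝ → ℝ, ContinuousOn f (Ioc 0 1) ∧ f =ᵐ[volD] u ∧ f 1 = c

/-- The space `(HtildeL (α-1) + span {x^(α-2)}) ∩ {u(1) = 0}` as a subspace of `L²(D)`. -/
def submoduleU (α : ℝ) : Submodule ℝ L2D where
  carrier := {u | (∃ u₀ ∈ HtildeL (α - 1), ∃ c : ℝ, u =ᵐ[volD] fun x => u₀ x + c * x ^ (α - 2)) ∧
    HasValueAtOne u 0}
  add_mem' := by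
    rintro u v ⟨⟨u₀, hu₀, c, hc⟩, f, hf, hfu, hf1⟩ ⟨⟨v₀, hv₀, d, hd⟩, g, hg, hgv, hg1⟩
    refine ⟨⟨u₀ + v₀, add_mem hu₀ hv₀, c + d, ?_⟩, f + g, hf.add hg, ?_, ?_⟩
    · filter_upwards [hc, hd, Lp.coeFn_add u v, Lp.coeFn_add u₀ v₀] with x h1 h2 h3 h4
      rw [h3, h4, Pi.add_apply, Pi.add_apply, h1, h2]
      ring
    · exact (hfu.add hgv).trans (Lp.coeFn_add u v).symm
    · simp [hf1, hg1]
  zero_mem' := by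
    refine ⟨⟨0, zero_mem _, 0, ?_⟩, 0, continuousOn_const, (Lp.coeFn_zero ℝ 2 volD).symm, rfl⟩
    filter_upwards with x
    ring
  smul_mem' := by
    rintro a u ⟨⟨u₀, hu₀, c, hc⟩, f, hf, hfu, hf1⟩
    refine ⟨⟨a • u₀, Submodule.smul_mem _ a hu₀, a * c, ?_⟩, a • f, hf.const_smul a, ?_, ?_⟩
    · filter_upwards [hc, Lp.coeFn_smul a u, Lp.coeFn_smul a u₀] with x h1 h3 h4
      rw [h3, h4, Pi.smul_apply, Pi.smul_apply, h1, smul_eq_mul, smul_eq_mul]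
      ring
    · exact (hfu.const_smul a).trans (Lp.coeFn_smul a u).symm
    · simp [hf1]

/-- The vector space `U`, without the norm inherited from `L²(D)`. -/
def SpaceU (α : ℝ) : Type := submoduleU α

instance (α : ℝ) : AddCommGroup (SpaceU α) := inferInstanceAs (AddCommGroup (submoduleU α))

instance (α : ℝ) : Module ℝ (SpaceU α) := inferInstanceAs (Module ℝ (submoduleU α))

/-- The underlying element of `L²(D)`. -/
def SpaceU.toL2 {α : ℝ} (u : SpaceU α) : L2D := Subtype.val u

/-- `u₀` is the function in `HtildeL (α-1)` with `u = u₀ - u₀(1) x^(α-2)`. -/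
def IsRegularPart (α : ℝ) (u u₀ : L2D) : Prop :=
  u₀ ∈ HtildeL (α - 1) ∧
    ∃ c : ℝ, HasValueAtOne u₀ c ∧ u =ᵐ[volD] fun x => u₀ x - c * x ^ (α - 2)

theorem exists_isRegularPart {α : ℝ} (u : SpaceU α) : ∃ u₀, IsRegularPart α u.toL2 u₀ := by
  obtain ⟨u, ⟨u₀, hu₀, c, hc⟩, f, hf, hfu, hf1⟩ := u
  refine ⟨u₀, hu₀, -c, ⟨fun x => f x - c * x ^ (α - 2), ?_, ?_, ?_⟩, ?_⟩
  · refine hf.sub (continuousOn_const.mul ?_)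
    exact fun x hx => (Real.continuousAt_rpow_const x _ (Or.inl hx.1.ne')).continuousWithinAt
  · filter_upwards [hc, hfu] with x h1 h2
    rw [h2, h1]
    ring
  · simp [hf1]
  · filter_upwards [hc] with x h1
    change u x = _
    rw [h1]
    ring

/-- The component `u₀` of `u = u₀ - u₀(1) x^(α-2)`. -/
def SpaceU.regularPart {α : ℝ} (u : SpaceU α) : L2D := (exists_isRegularPart u).choose

/-- The functional `‖u‖_U = ‖D^(α-1) u₀‖_{L²(D)}`. -/
instance (α : ℝ) : Norm (SpaceU α) := ⟨fun u => ‖rlDeriv (α - 1) u.regularPart‖⟩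

end

end FracMixed

/-!
Write `s = α - 1 ∈ (1/2, 1)`, let `I^s` be the Riemann-Liouville integral of order `s` and `D^s` the
derivative of order `s`. Everything follows from the statement that `I^s` is an isomorphism of
`L²(D)` onto `HtildeL s` with inverse `D^s`. Then `D^s u₀` runs through all of `L²(D)` as `u` runs
through `U`, so `U` is isometric to `L²(D)` and hence complete. The representation
`u = u₀ - u₀(1) x^(s-1)` is unique because, for `s > 1/2`, functions `I^s g` are continuous and
vanish at `0` (`eq_zero_of_rpow_ae_eq_conv`).

* *`I^s` maps `L²(D)` boundedly into `HtildeL s`* (`exists_normHtildeL_le`). An increment of `I^s g`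
  with step `h` is the convolution of `g` with an increment of the kernel `x₊^(s-1)/Γ(s)`. This
  increment of the kernel is integrable, and its Fourier transform is at most
  `C min(1, h|ξ|) |ξ|^(-s)` (`norm_fourier_rlKernelDiff_le`). By Plancherel's theorem the Gagliardo
  energy of `I^s g` is bounded by the integral of `|ĝ(ξ)|²` times
  `∫_0^∞ h^(-1-2s) min(1, h|ξ|)² |ξ|^(-2s) dh`, which does not depend on `ξ`. The semigroup property
  `I^(1-s) I^s = I^1` gives `D^s I^s g = g` (`isRLDeriv_of_ae_eq_conv`).

* *Each `φ` in `HtildeL s` is `I^s g` with `‖g‖ ≤ C ‖φ‖`* (`exists_eq_conv_of_mem_HtildeL`). Let `F`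
  be the even reflection about `1` of the extension of `φ` by zero. On the Fourier side its
  Gagliardo energy is `∫ |ξ|^(2s) |F̂(ξ)|² dξ` up to a constant, so the same kernel estimate, now of
  order `1 - s`, shows that the difference quotients of `v = I^(1-s) F` are bounded in `L²`
  (`lintegral_conv_rlKernelDiff_one_sub_le`). As `v = 0` on `(-∞,0]`, the derivative of `v` is
  bounded in `L²(D)` even against test functions which do not vanish at `0`, and by duality
  `v = ∫_0^x g` with no additive constant (`exists_primitive_of_bounded`). Therefore
  `I^(1-s) (φ - I^s g) = 0`, and applying `I^s` gives `φ = I^s g`.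
-/

open MeasureTheory Set

namespace FracMixed

noncomputable section

open scoped FourierTransform ENNReal ContDiff SchwartzMap Topology Convolution
open Filter

/-! ### Plancherel's theorem for integrable functions -/

theorem integral_fourier_schwartz_mul_of_integrable {f : ℝ → ℂ} (hf : Integrable f) (φ : 𝓢(ℝ, ℂ)) :
    ∫ x, (𝓕 φ) x * f x = ∫ x, φ x * (𝓕 f) x := by
  have h := VectorFourier.integral_fourierIntegral_smul_eq_flip (L := innerₗ ℝ)
    (μ := (volume : Measure ℝ)) (ν := (volume : Measure ℝ)) (f := φ) (g := f)
    Real.continuous_fourierChar (by exact continuous_inner) φ.integrable hf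
  rw [flip_innerₗ] at h
  simp only [smul_eq_mul] at h
  exact h

theorem integral_fourier_schwartz_mul_Lp (U : Lp ℂ 2 (volume : Measure ℝ)) (φ : 𝓢(ℝ, ℂ)) :
    ∫ x, (𝓕 φ) x * U x = ∫ x, φ x * (𝓕 U : Lp ℂ 2 (volume : Measure ℝ)) x := by
  have h := congrArg (fun T => T φ) (Lp.fourier_toTemperedDistribution_eq U)
  simpa [TemperedDistribution.fourier_apply] using h

theorem ae_eq_of_integral_schwartz_mul_eq {f g : ℝ → ℂ} (hf : LocallyIntegrable f)
    (hg : LocallyIntegrable g) (h : ∀ φ : 𝓢(ℝ, ℂ), ∫ x, φ x * f x = ∫ x, φ x * g x) :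
    f =ᵐ[volume] g := by
  refine ae_eq_of_integral_contDiff_smul_eq hf hg fun u hu hc => ?_
  have hc' : HasCompactSupport (Complex.ofRealCLM ∘ u) := hc.comp_left rfl
  have hu' : ContDiff ℝ ∞ (Complex.ofRealCLM ∘ u) := by fun_prop
  simpa using h (hc'.toSchwartzMap hu')

theorem lintegral_enorm_sq_Lp (U : Lp ℂ 2 (volume : Measure ℝ)) :
    ∫⁻ x, ‖U x‖ₑ ^ 2 = ‖U‖ₑ ^ 2 := by
  rw [Lp.enorm_def, eLpNorm_eq_lintegral_rpow_enorm_toReal (by norm_num) (by norm_num),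
    ← ENNReal.rpow_natCast, ← ENNReal.rpow_mul]
  simp

/-- Plancherel's theorem for an integrable function. No square integrability is needed: if one of
the two sides is finite, so is the other. -/
theorem lintegral_enorm_fourier_sq {f : ℝ → ℂ} (hf : Integrable f) :
    ∫⁻ ξ, ‖𝓕 f ξ‖ₑ ^ 2 = ∫⁻ x, ‖f x‖ₑ ^ 2 := by
  have hcont : Continuous (𝓕 f) :=
    VectorFourier.fourierIntegral_continuous Real.continuous_fourierChar
      (by exact continuous_inner) hf
  have key : ∀ U : Lp ℂ 2 (volume : Measure ℝ), f =ᵐ[volume] U →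
      𝓕 f =ᵐ[volume] (𝓕 U : Lp ℂ 2 (volume : Measure ℝ)) →
      ∫⁻ ξ, ‖𝓕 f ξ‖ₑ ^ 2 = ∫⁻ x, ‖f x‖ₑ ^ 2 := by
    intro U h1 h2
    have e1 : ∫⁻ x, ‖f x‖ₑ ^ 2 = ∫⁻ x, ‖U x‖ₑ ^ 2 :=
      lintegral_congr_ae (by filter_upwards [h1] with x hx; rw [hx])
    have e2 : ∫⁻ x, ‖𝓕 f x‖ₑ ^ 2 = ∫⁻ x, ‖(𝓕 U : Lp ℂ 2 (volume : Measure ℝ)) x‖ₑ ^ 2 :=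
      lintegral_congr_ae (by filter_upwards [h2] with x hx; rw [hx])
    rw [e1, e2, lintegral_enorm_sq_Lp, lintegral_enorm_sq_Lp, ← ofReal_norm, ← ofReal_norm,
      Lp.norm_fourier_eq]
  by_cases h1 : MemLp (𝓕 f) 2
  · set W := h1.toLp (𝓕 f)
    set U : Lp ℂ 2 (volume : Measure ℝ) := 𝓕⁻ W
    have hU : 𝓕 U = W := FourierTransform.fourier_fourierInv_eq W
    have hW : W =ᵐ[volume] 𝓕 f := h1.coeFn_toLp
    refine key U ?_ (by rw [hU]; exact hW.symm)
    refine ae_eq_of_integral_schwartz_mul_eq hf.locallyIntegrable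
      ((Lp.memLp U).locallyIntegrable (by norm_num)) fun φ => ?_
    have hφ : 𝓕 (𝓕⁻ φ) = φ := FourierTransform.fourier_fourierInv_eq φ
    rw [← hφ, integral_fourier_schwartz_mul_of_integrable hf, integral_fourier_schwartz_mul_Lp, hU]
    refine integral_congr_ae ?_
    filter_upwards [hW] with x hx
    rw [hx]
  by_cases h2 : MemLp f 2
  · set U := h2.toLp f
    have hU : U =ᵐ[volume] f := h2.coeFn_toLp
    refine key U hU.symm ?_
    refine ae_eq_of_integral_schwartz_mul_eq hcont.locallyIntegrable
      ((Lp.memLp _).locallyIntegrable (by norm_num)) fun φ => ?_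
    rw [← integral_fourier_schwartz_mul_of_integrable hf, ← integral_fourier_schwartz_mul_Lp]
    refine integral_congr_ae ?_
    filter_upwards [hU] with x hx
    rw [hx]
  · have top : ∀ g : ℝ → ℂ, AEStronglyMeasurable g → ¬ MemLp g 2 → ∫⁻ x, ‖g x‖ₑ ^ 2 = ⊤ := by
      intro g hg hn
      by_contra hne
      refine hn ⟨hg, ?_⟩
      rw [eLpNorm_lt_top_iff_lintegral_rpow_enorm_lt_top (by norm_num) (by norm_num)]
      simpa using lt_top_iff_ne_top.2 hne
    rw [top _ hcont.aestronglyMeasurable h1, top _ hf.aestronglyMeasurable h2]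

/-! ### The fractional kernel and the symbols of its increments -/

/-- The kernel `x₊^(a-1) / Γ(a)` of the left-sided Riemann-Liouville integral of order `a`. -/
def rlKernel (a : ℝ) : ℝ → ℝ := (Ioi 0).indicator fun z => z ^ (a - 1) / Real.Gamma a

/-- The backward difference with step `h` of the kernel `rlKernel a`. Unlike the kernel, it is
integrable on the whole line. -/
def rlKernelDiff (a h z : ℝ) : ℝ := rlKernel a z - rlKernel a (z - h)

theorem rlKernel_of_pos {a z : ℝ} (hz : 0 < z) : rlKernel a z = z ^ (a - 1) / Real.Gamma a :=
  indicator_of_mem hz _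

theorem rlKernel_of_nonpos {a z : ℝ} (hz : z ≤ 0) : rlKernel a z = 0 :=
  indicator_of_notMem (by simpa using hz) _

/-- Bernoulli's inequality for the exponent `a ∈ (0,1)`, rescaled. -/
theorem rpow_sub_rpow_sub_le {a h z : ℝ} (ha0 : 0 < a) (ha1 : a < 1) (hh : 0 < h) (hz : h < z) :
    z ^ a - (z - h) ^ a ≤ a * h * (z - h) ^ (a - 1) := by
  have hw : 0 < z - h := sub_pos.2 hz
  have e : z = (z - h) * (1 + h / (z - h)) := by field_simp; ring
  have h1 : (1 + h / (z - h)) ^ a ≤ 1 + a * (h / (z - h)) :=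
    rpow_one_add_le_one_add_mul_self (by have := div_pos hh hw; linarith) ha0.le ha1.le
  have h2 : z ^ a = (z - h) ^ a * (1 + h / (z - h)) ^ a := by
    conv_lhs => rw [e]
    rw [Real.mul_rpow hw.le (by positivity)]
  have h3 : (z - h) ^ (a - 1) = (z - h) ^ a / (z - h) := by
    rw [Real.rpow_sub_one hw.ne']
  rw [h2, h3]
  have h4 := mul_le_mul_of_nonneg_left h1 (Real.rpow_nonneg hw.le a)
  have h5 : a * h * ((z - h) ^ a / (z - h)) =
      (z - h) ^ a * (1 + a * (h / (z - h))) - (z - h) ^ a := by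
    field_simp; ring
  linarith

theorem tendsto_rpow_sub_rpow_sub {a h : ℝ} (ha0 : 0 < a) (ha1 : a < 1) (hh : 0 < h) :
    Tendsto (fun z : ℝ => z ^ a - (z - h) ^ a) atTop (𝓝 0) := by
  have h1 : Tendsto (fun z : ℝ => a * h * (z - h) ^ (a - 1)) atTop (𝓝 0) := by
    have := (tendsto_rpow_neg_atTop (y := 1 - a) (by linarith)).comp
      (tendsto_atTop_add_const_right atTop (-h) tendsto_id)
    have h2 := this.const_mul (a * h)
    rw [mul_zero] at h2
    refine h2.congr fun z => ?_
    simp [sub_eq_add_neg, add_comm]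
  refine tendsto_of_tendsto_of_tendsto_of_le_of_le' tendsto_const_nhds h1 ?_ ?_
  · filter_upwards [eventually_gt_atTop h] with z hz
    exact sub_nonneg.2 (Real.rpow_le_rpow (by linarith) (by linarith) ha0.le)
  · filter_upwards [eventually_gt_atTop h] with z hz
    exact rpow_sub_rpow_sub_le ha0 ha1 hh hz

theorem integrableOn_rpow_sub_rpow_sub {a h : ℝ} (ha0 : 0 < a) (ha1 : a < 1) (hh : 0 < h) :
    IntegrableOn (fun z : ℝ => z ^ (a - 1) - (z - h) ^ (a - 1)) (Ioi h) ∧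
      ∫ z in Ioi h, (z ^ (a - 1) - (z - h) ^ (a - 1)) = -(h ^ a / a) := by
  have hcont : ContinuousWithinAt (fun z : ℝ => (z ^ a - (z - h) ^ a) / a) (Ici h) h := by
    refine ContinuousAt.continuousWithinAt (ContinuousAt.div_const (ContinuousAt.sub ?_ ?_) a)
    · exact Real.continuousAt_rpow_const _ _ (Or.inr ha0.le)
    · exact (Real.continuousAt_rpow_const _ _ (Or.inr ha0.le)).comp
        (continuousAt_id.sub continuousAt_const)
  have hder : ∀ z ∈ Ioi h, HasDerivAt (fun z : ℝ => (z ^ a - (z - h) ^ a) / a)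
      (z ^ (a - 1) - (z - h) ^ (a - 1)) z := by
    intro z hz
    have hz' : h < z := hz
    have d1 := Real.hasDerivAt_rpow_const (x := z) (p := a) (Or.inl (by linarith))
    have d2 := ((hasDerivAt_id z).sub_const h).rpow_const (p := a)
      (Or.inl (by simp; linarith))
    convert! (d1.sub d2).div_const a using 1
    simp only [id]
    field_simp
  have hneg : ∀ z ∈ Ioi h, z ^ (a - 1) - (z - h) ^ (a - 1) ≤ 0 := by
    intro z hz
    have hz' : h < z := hz
    exact sub_nonpos.2 (Real.rpow_le_rpow_of_nonpos (by linarith) (by linarith) (by linarith))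
  have hlim : Tendsto (fun z : ℝ => (z ^ a - (z - h) ^ a) / a) atTop (𝓝 0) := by
    simpa using (tendsto_rpow_sub_rpow_sub ha0 ha1 hh).div_const a
  refine ⟨integrableOn_Ioi_deriv_of_nonpos hcont hder hneg hlim, ?_⟩
  rw [integral_Ioi_of_hasDerivAt_of_nonpos hcont hder hneg hlim]
  simp [Real.zero_rpow ha0.ne']

theorem rlKernelDiff_of_lt {a h z : ℝ} (hh : 0 < h) (hz : h < z) :
    rlKernelDiff a h z = (z ^ (a - 1) - (z - h) ^ (a - 1)) / Real.Gamma a := by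
  rw [rlKernelDiff, rlKernel_of_pos (by linarith), rlKernel_of_pos (by linarith), sub_div]

theorem rlKernelDiff_of_mem_Ioc {a h z : ℝ} (hz : z ∈ Ioc 0 h) :
    rlKernelDiff a h z = z ^ (a - 1) / Real.Gamma a := by
  rw [rlKernelDiff, rlKernel_of_pos hz.1, rlKernel_of_nonpos (by linarith [hz.2]), sub_zero]

theorem rlKernelDiff_of_nonpos {a h z : ℝ} (hh : 0 < h) (hz : z ≤ 0) : rlKernelDiff a h z = 0 := by
  rw [rlKernelDiff, rlKernel_of_nonpos hz, rlKernel_of_nonpos (by linarith), sub_zero]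

theorem integrableOn_Ioc_rpow {a h : ℝ} (ha0 : 0 < a) (hh : 0 < h) :
    IntegrableOn (fun z : ℝ => z ^ (a - 1)) (Ioc 0 h) :=
  (intervalIntegrable_iff_integrableOn_Ioc_of_le hh.le).1
    (intervalIntegral.intervalIntegrable_rpow' (by linarith))

theorem integrable_rlKernelDiff {a h : ℝ} (ha0 : 0 < a) (ha1 : a < 1) (hh : 0 < h) :
    Integrable (rlKernelDiff a h) := by
  have h1 : IntegrableOn (rlKernelDiff a h) (Iic 0) :=
    integrableOn_zero.congr_fun (fun z hz => (rlKernelDiff_of_nonpos hh hz).symm)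
      measurableSet_Iic
  have h2 : IntegrableOn (rlKernelDiff a h) (Ioc 0 h) :=
    IntegrableOn.congr_fun ((integrableOn_Ioc_rpow ha0 hh).div_const _)
      (fun z hz => (rlKernelDiff_of_mem_Ioc hz).symm) measurableSet_Ioc
  have h3 : IntegrableOn (rlKernelDiff a h) (Ioi h) :=
    IntegrableOn.congr_fun ((integrableOn_rpow_sub_rpow_sub ha0 ha1 hh).1.div_const _)
      (fun z hz => (rlKernelDiff_of_lt hh hz).symm) measurableSet_Ioi
  have h4 := (h1.union h2).union h3
  rwa [Iic_union_Ioc_eq_Iic hh.le, Iic_union_Ioi, integrableOn_univ] at h4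

theorem integral_abs_rlKernelDiff {a h : ℝ} (ha0 : 0 < a) (ha1 : a < 1) (hh : 0 < h) :
    ∫ z, |rlKernelDiff a h z| = 2 / (a * Real.Gamma a) * h ^ a := by
  have hG : 0 < Real.Gamma a := Real.Gamma_pos_of_pos ha0
  have hi := (integrable_rlKernelDiff ha0 ha1 hh).abs
  have e1 : ∫ z in Iic 0, |rlKernelDiff a h z| = 0 := by
    rw [setIntegral_congr_fun measurableSet_Iic
      (fun z hz => by rw [rlKernelDiff_of_nonpos hh hz, abs_zero])]
    simp
  have e2 : ∫ z in Ioc 0 h, |rlKernelDiff a h z| = h ^ a / a / Real.Gamma a := by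
    rw [setIntegral_congr_fun (g := fun z => z ^ (a - 1) / Real.Gamma a) measurableSet_Ioc
      (fun z hz => by
        rw [rlKernelDiff_of_mem_Ioc hz,
          abs_of_nonneg (div_nonneg (Real.rpow_nonneg hz.1.le _) hG.le)]),
      integral_div, ← intervalIntegral.integral_of_le hh.le, integral_rpow (Or.inl (by linarith))]
    simp [Real.zero_rpow ha0.ne']
  have e3 : ∫ z in Ioi h, |rlKernelDiff a h z| = h ^ a / a / Real.Gamma a := by
    rw [setIntegral_congr_fun
      (g := fun z => -((z ^ (a - 1) - (z - h) ^ (a - 1)) / Real.Gamma a)) measurableSet_Ioi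
      (fun z hz => by
        have hz' : h < z := hz
        rw [rlKernelDiff_of_lt hh hz, abs_of_nonpos]
        exact div_nonpos_of_nonpos_of_nonneg (sub_nonpos.2
          (Real.rpow_le_rpow_of_nonpos (by linarith) (by linarith) (by linarith))) hG.le),
      integral_neg, integral_div, (integrableOn_rpow_sub_rpow_sub ha0 ha1 hh).2]
    ring
  have s1 : ∫ z in Ioi 0, |rlKernelDiff a h z| =
      h ^ a / a / Real.Gamma a + h ^ a / a / Real.Gamma a := by
    rw [← Ioc_union_Ioi_eq_Ioi hh.le, setIntegral_union (Ioc_disjoint_Ioi le_rfl) measurableSet_Ioi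
      hi.integrableOn hi.integrableOn, e2, e3]
  rw [← integral_add_compl measurableSet_Iic hi, compl_Iic, e1, s1]
  field_simp
  ring

theorem fourier_comp_sub (f : ℝ → ℂ) (h ξ : ℝ) :
    𝓕 (fun x => f (x - h)) ξ = (Real.fourierChar (-(h * ξ)) : ℂ) * 𝓕 f ξ := by
  have := congrFun (VectorFourier.fourierIntegral_comp_add_right Real.fourierChar volume
    (innerₗ ℝ) f (-h)) ξ
  have e : inner ℝ (-h) ξ = -(h * ξ) := by simp [mul_comm]
  simp only [innerₗ_apply_apply, e, Circle.smul_def, smul_eq_mul] at this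
  exact this

theorem norm_one_sub_fourierChar (t : ℝ) :
    ‖1 - (Real.fourierChar (-t) : ℂ)‖ = 2 * |Real.sin (Real.pi * t)| := by
  have h := Complex.norm_exp_I_mul_ofReal_sub_one (2 * Real.pi * -t)
  rw [norm_sub_rev, Real.fourierChar_apply, mul_comm _ Complex.I, h, norm_mul,
    show 2 * Real.pi * -t / 2 = -(Real.pi * t) by ring, Real.sin_neg]
  simp

theorem fourier_sub_comp_sub {f : ℝ → ℂ} (hf : Integrable f) (h ξ : ℝ) :
    𝓕 (fun x => f x - f (x - h)) ξ = (1 - (Real.fourierChar (-(h * ξ)) : ℂ)) * 𝓕 f ξ := by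
  have e : 𝓕 (fun x => f x - f (x - h)) ξ = 𝓕 f ξ - 𝓕 (fun x => f (x - h)) ξ := by
    simp only [Real.fourier_eq, smul_sub]
    exact integral_sub ((Real.fourierIntegral_convergent_iff ξ).2 hf)
      ((Real.fourierIntegral_convergent_iff ξ).2 (hf.comp_sub_right h))
  rw [e, fourier_comp_sub]
  ring

/-- The symbol of the increment with step `h` of the kernel of order `a` is at most
`C min(1, h|ξ|) |ξ|^(-a)`. The Fourier transform of the kernel itself, which is not integrable, is
avoided by comparing the step `h` with the step `b = 1 / (2|ξ|)`: taking increments commutes, and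
the factor `1 - exp(-2πibξ)` is `2`. -/
theorem norm_fourier_rlKernelDiff_le {a h ξ : ℝ} (ha0 : 0 < a) (ha1 : a < 1) (hh : 0 < h)
    (hξ : ξ ≠ 0) :
    ‖𝓕 (fun z => (rlKernelDiff a h z : ℂ)) ξ‖ ≤
      8 / (a * Real.Gamma a) * (min 1 (h * |ξ|) * |ξ| ^ (-a)) := by
  have hξ' : 0 < |ξ| := abs_pos.2 hξ
  set b : ℝ := 1 / (2 * |ξ|) with hb
  have hb0 : 0 < b := by positivity
  have hG : 0 < Real.Gamma a := Real.Gamma_pos_of_pos ha0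
  have e1 := fourier_sub_comp_sub (Integrable.ofReal (𝕜 := ℂ)
    (integrable_rlKernelDiff ha0 ha1 hh)) b ξ
  have e2 := fourier_sub_comp_sub (Integrable.ofReal (𝕜 := ℂ)
    (integrable_rlKernelDiff ha0 ha1 hb0)) h ξ
  -- Taking increments with steps `h` and `b` commutes.
  have e3 : (fun z => ((rlKernelDiff a h z : ℝ) : ℂ) - ((rlKernelDiff a h (z - b) : ℝ) : ℂ)) =
      fun z => ((rlKernelDiff a b z : ℝ) : ℂ) - ((rlKernelDiff a b (z - h) : ℝ) : ℂ) := by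
    funext z
    simp only [rlKernelDiff, show z - b - h = z - h - b by ring]
    push_cast
    ring
  simp only [RCLike.ofReal_eq_complex_ofReal] at e1 e2
  rw [e3, e2] at e1
  have e4 := congrArg norm e1
  -- The choice of `b` makes `|1 - exp(-2πibξ)| = 2 |sin(πbξ)|` equal to `2`.
  have hbξ : |Real.sin (Real.pi * (b * ξ))| = 1 := by
    rcases lt_or_gt_of_ne hξ with hneg | hpos
    · rw [hb, abs_of_neg hneg, show Real.pi * (1 / (2 * -ξ) * ξ) = -(Real.pi / 2) by field_simp]
      simp
    · rw [hb, abs_of_pos hpos, show Real.pi * (1 / (2 * ξ) * ξ) = Real.pi / 2 by field_simp]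
      simp
  rw [norm_mul, norm_mul, norm_one_sub_fourierChar, norm_one_sub_fourierChar, hbξ] at e4
  have h5 : ‖𝓕 (fun z => ((rlKernelDiff a b z : ℝ) : ℂ)) ξ‖ ≤ 2 / (a * Real.Gamma a) * b ^ a := by
    have := VectorFourier.norm_fourierIntegral_le_integral_norm Real.fourierChar volume
      (innerₗ ℝ) (fun z => ((rlKernelDiff a b z : ℝ) : ℂ)) ξ
    refine this.trans (le_of_eq ?_)
    rw [← integral_abs_rlKernelDiff ha0 ha1 hb0]
    simp
  have h6 : b ^ a ≤ |ξ| ^ (-a) := by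
    rw [Real.rpow_neg hξ'.le, ← Real.inv_rpow hξ'.le]
    refine Real.rpow_le_rpow hb0.le ?_ ha0.le
    rw [hb, inv_eq_one_div]
    exact one_div_le_one_div_of_le hξ' (by linarith)
  have h7 : |Real.sin (Real.pi * (h * ξ))| ≤ 4 * min 1 (h * |ξ|) := by
    rcases min_cases 1 (h * |ξ|) with ⟨hm, _⟩ | ⟨hm, _⟩
    · rw [hm]
      linarith [Real.abs_sin_le_one (Real.pi * (h * ξ))]
    · rw [hm]
      refine Real.abs_sin_le_abs.trans ?_
      rw [abs_mul, abs_mul, abs_of_pos Real.pi_pos, abs_of_pos hh]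
      exact mul_le_mul_of_nonneg_right Real.pi_le_four (by positivity)
  have h8 : ‖𝓕 (fun z => ((rlKernelDiff a h z : ℝ) : ℂ)) ξ‖ =
      |Real.sin (Real.pi * (h * ξ))| * ‖𝓕 (fun z => ((rlKernelDiff a b z : ℝ) : ℂ)) ξ‖ := by
    linarith
  rw [h8]
  have h9 : 0 ≤ min 1 (h * |ξ|) := by positivity
  calc _ ≤ (4 * min 1 (h * |ξ|)) * (2 / (a * Real.Gamma a) * |ξ| ^ (-a)) := by
        refine mul_le_mul h7 (h5.trans ?_) (norm_nonneg _) (by positivity)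
        exact mul_le_mul_of_nonneg_left h6 (by positivity)
    _ = _ := by ring

/-! ### Gagliardo seminorms on the Fourier side -/

/-- The convolution `x ↦ ∫ f(t) k(x - t) dt` of real functions on the line. -/
abbrev conv (f k : ℝ → ℝ) : ℝ → ℝ := f ⋆[ContinuousLinearMap.mul ℝ ℝ] k

theorem conv_apply (f k : ℝ → ℝ) (x : ℝ) : conv f k x = ∫ t, f t * k (x - t) := rfl

theorem enorm_sq_eq_ofReal (r : ℝ) : ‖r‖ₑ ^ 2 = ENNReal.ofReal (r ^ 2) := by
  rw [Real.enorm_eq_ofReal_abs, ← ENNReal.ofReal_pow (abs_nonneg r), sq_abs]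

theorem enorm_sq_eq_ofReal_norm (z : ℂ) : ‖z‖ₑ ^ 2 = ENNReal.ofReal (‖z‖ ^ 2) := by
  rw [← ofReal_norm, ← ENNReal.ofReal_pow (norm_nonneg z)]

theorem enorm_complex_ofReal (r : ℝ) : ‖(r : ℂ)‖ₑ = ‖r‖ₑ := by
  rw [← ofReal_norm, ← ofReal_norm, Complex.norm_real]

theorem lintegral_enorm_sq_eq_fourier {f : ℝ → ℝ} (hf : Integrable f) :
    ∫⁻ x, ‖f x‖ₑ ^ 2 = ∫⁻ ξ, ‖𝓕 (fun x => (f x : ℂ)) ξ‖ₑ ^ 2 := by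
  have h := lintegral_enorm_fourier_sq (Integrable.ofReal (𝕜 := ℂ) hf)
  simp only [RCLike.ofReal_eq_complex_ofReal, enorm_complex_ofReal] at h
  exact h.symm

theorem fourier_conv {f k : ℝ → ℝ} (hf : Integrable f) (hk : Integrable k) (ξ : ℝ) :
    𝓕 (fun x => (conv f k x : ℂ)) ξ =
      𝓕 (fun x => (f x : ℂ)) ξ * 𝓕 (fun x => (k x : ℂ)) ξ := by
  have h := Real.fourier_mul_convolution_eq (R := ℂ) (Integrable.ofReal (𝕜 := ℂ) hf)
    (Integrable.ofReal (𝕜 := ℂ) hk) ξ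
  simp only [RCLike.ofReal_eq_complex_ofReal] at h
  have e : (fun x => (conv f k x : ℂ)) =
      (fun x => (f x : ℂ)) ⋆[ContinuousLinearMap.mul ℂ ℂ] fun x => (k x : ℂ) := by
    funext x
    rw [conv_apply, convolution_def, ← integral_complex_ofReal]
    simp
  rw [← h, e]

theorem lintegral_enorm_conv_sq {f k : ℝ → ℝ} (hf : Integrable f) (hk : Integrable k) :
    ∫⁻ x, ‖conv f k x‖ₑ ^ 2 =
      ∫⁻ ξ, ‖𝓕 (fun x => (f x : ℂ)) ξ‖ₑ ^ 2 * ‖𝓕 (fun x => (k x : ℂ)) ξ‖ₑ ^ 2 := by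
  rw [lintegral_enorm_sq_eq_fourier (hf.integrable_convolution _ hk)]
  refine lintegral_congr fun ξ => ?_
  rw [fourier_conv hf hk, enorm_mul, mul_pow]

theorem continuous_fourier_ofReal {f : ℝ → ℝ} (hf : Integrable f) :
    Continuous (𝓕 fun x => (f x : ℂ)) :=
  VectorFourier.fourierIntegral_continuous Real.continuous_fourierChar
    (by exact continuous_inner) (Integrable.ofReal (𝕜 := ℂ) hf)

theorem lintegral_Ioc_rpow {c r : ℝ} (hr : -1 < r) (hc : 0 < c) :
    ∫⁻ h in Ioc 0 c, ENNReal.ofReal (h ^ r) = ENNReal.ofReal (c ^ (r + 1) / (r + 1)) := by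
  rw [← ofReal_integral_eq_lintegral_ofReal, ← intervalIntegral.integral_of_le hc.le,
    integral_rpow (Or.inl hr), Real.zero_rpow (by linarith), sub_zero]
  · exact (intervalIntegrable_iff_integrableOn_Ioc_of_le hc.le).1
      (intervalIntegral.intervalIntegrable_rpow' hr)
  · exact (ae_restrict_mem measurableSet_Ioc).mono fun h hh => Real.rpow_nonneg hh.1.le _

theorem lintegral_Ioi_rpow {c r : ℝ} (hr : r < -1) (hc : 0 < c) :
    ∫⁻ h in Ioi c, ENNReal.ofReal (h ^ r) = ENNReal.ofReal (-c ^ (r + 1) / (r + 1)) := by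
  rw [← ofReal_integral_eq_lintegral_ofReal, integral_Ioi_rpow_of_lt hr hc]
  · exact integrableOn_Ioi_rpow_of_lt hr hc
  · exact (ae_restrict_mem measurableSet_Ioi).mono fun h hh =>
      Real.rpow_nonneg (hc.le.trans (le_of_lt hh)) _

/-- The substitution `h ↦ h / t` shows that the integral does not depend on `t`; it is bounded by
splitting at `h = 1 / t`. -/
theorem lintegral_rpow_mul_min_sq_le {s t : ℝ} (hs0 : 0 < s) (hs1 : s < 1) (ht : 0 < t) :
    ∫⁻ h in Ioi 0, ENNReal.ofReal (h ^ (-1 - 2 * s) * (min 1 (h * t) * t ^ (-s)) ^ 2) ≤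
      ENNReal.ofReal (1 / (2 - 2 * s) + 1 / (2 * s)) := by
  have hc : 0 < 1 / t := by positivity
  have htt : (t ^ (-s)) ^ 2 = t ^ (-(2 * s)) := by
    rw [← Real.rpow_natCast, ← Real.rpow_mul ht.le]; congr 1; push_cast; ring
  rw [← Ioc_union_Ioi_eq_Ioi hc.le, lintegral_union measurableSet_Ioi (Ioc_disjoint_Ioi le_rfl),
    ENNReal.ofReal_add (by have : 0 < 2 - 2 * s := by linarith
                           positivity) (by positivity)]
  refine add_le_add ?_ ?_
  · calc _ ≤ ∫⁻ h in Ioc 0 (1 / t), ENNReal.ofReal (t ^ (2 - 2 * s)) *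
          ENNReal.ofReal (h ^ (1 - 2 * s)) := by
          refine setLIntegral_mono' measurableSet_Ioc fun h hh => ?_
          rw [← ENNReal.ofReal_mul (by positivity)]
          refine ENNReal.ofReal_le_ofReal ?_
          have h0 : 0 < h := hh.1
          have h1 : min 1 (h * t) ^ 2 ≤ (h * t) ^ 2 :=
            pow_le_pow_left₀ (by positivity) (min_le_right _ _) 2
          rw [mul_pow, htt]
          calc h ^ (-1 - 2 * s) * (min 1 (h * t) ^ 2 * t ^ (-(2 * s)))
              ≤ h ^ (-1 - 2 * s) * ((h * t) ^ 2 * t ^ (-(2 * s))) := by gcongr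
            _ = (t ^ 2 * t ^ (-(2 * s))) * (h ^ (-1 - 2 * s) * h ^ 2) := by ring
            _ = _ := by
              rw [← Real.rpow_natCast, ← Real.rpow_natCast, ← Real.rpow_add ht,
                ← Real.rpow_add h0]
              congr 2
              push_cast
              ring
      _ = _ := by
          rw [lintegral_const_mul _ (by fun_prop), lintegral_Ioc_rpow (by linarith) hc,
            ← ENNReal.ofReal_mul (by positivity)]
          congr 1
          rw [one_div, Real.inv_rpow ht.le, show 1 - 2 * s + 1 = 2 - 2 * s by ring]
          field_simp
  · calc _ ≤ ∫⁻ h in Ioi (1 / t), ENNReal.ofReal (t ^ (-(2 * s))) *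
          ENNReal.ofReal (h ^ (-1 - 2 * s)) := by
          refine setLIntegral_mono' measurableSet_Ioi fun h hh => ?_
          rw [← ENNReal.ofReal_mul (by positivity)]
          refine ENNReal.ofReal_le_ofReal ?_
          have h0 : 0 < h := hc.trans hh
          have h1 : min 1 (h * t) ^ 2 ≤ 1 ^ 2 :=
            pow_le_pow_left₀ (by positivity) (min_le_left _ _) 2
          rw [mul_pow, htt]
          calc h ^ (-1 - 2 * s) * (min 1 (h * t) ^ 2 * t ^ (-(2 * s)))
              ≤ h ^ (-1 - 2 * s) * (1 ^ 2 * t ^ (-(2 * s))) := by gcongr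
            _ = _ := by ring
      _ = _ := by
          rw [lintegral_const_mul _ (by fun_prop), lintegral_Ioi_rpow (by linarith) hc,
            ← ENNReal.ofReal_mul (by positivity)]
          congr 1
          rw [one_div, Real.inv_rpow ht.le, show -1 - 2 * s + 1 = -(2 * s) by ring]
          field_simp

/-- The Gagliardo energy of the Riemann-Liouville integral of order `s` of `G` is controlled by
the `L²` norm of `G`; on the Fourier side the integral over the steps `h` is bounded uniformly in
the frequency. -/
theorem lintegral_lintegral_conv_rlKernelDiff_le {s : ℝ} (hs0 : 0 < s) (hs1 : s < 1) :
    ∃ C : ℝ, 0 < C ∧ ∀ G : ℝ → ℝ, Integrable G →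
      ∫⁻ h in Ioi 0, ENNReal.ofReal (h ^ (-1 - 2 * s)) *
        ∫⁻ x, ‖conv G (rlKernelDiff s h) x‖ₑ ^ 2 ≤ ENNReal.ofReal C * ∫⁻ x, ‖G x‖ₑ ^ 2 := by
  set A : ℝ := 8 / (s * Real.Gamma s)
  have hA : 0 < A := by have := Real.Gamma_pos_of_pos hs0; positivity
  have hB : 0 < 1 / (2 - 2 * s) + 1 / (2 * s) := by
    have : 0 < 2 - 2 * s := by linarith
    positivity
  refine ⟨A ^ 2 * (1 / (2 - 2 * s) + 1 / (2 * s)), by positivity, fun G hG => ?_⟩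
  set g := fun ξ => ‖𝓕 (fun x => (G x : ℂ)) ξ‖ₑ ^ 2 with hg
  have hgm : Measurable g := by
    have := (continuous_fourier_ofReal hG).measurable
    fun_prop
  have hne : ∀ᵐ ξ : ℝ, ξ ≠ 0 := by simp [ae_iff]
  calc _ ≤ ∫⁻ h in Ioi 0, ∫⁻ ξ, ENNReal.ofReal (A ^ 2) * g ξ *
        ENNReal.ofReal (h ^ (-1 - 2 * s) * (min 1 (h * |ξ|) * |ξ| ^ (-s)) ^ 2) := by
        refine setLIntegral_mono' measurableSet_Ioi fun h hh => ?_
        have h0 : 0 < h := hh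
        rw [lintegral_enorm_conv_sq hG (integrable_rlKernelDiff hs0 hs1 hh),
          ← lintegral_const_mul' _ _ ENNReal.ofReal_ne_top]
        refine lintegral_mono_ae (hne.mono fun ξ hξ => ?_)
        have h1 : ‖𝓕 (fun z => (rlKernelDiff s h z : ℂ)) ξ‖ₑ ^ 2 ≤
            ENNReal.ofReal (A ^ 2 * (min 1 (h * |ξ|) * |ξ| ^ (-s)) ^ 2) := by
          rw [enorm_sq_eq_ofReal_norm, ← mul_pow]
          exact ENNReal.ofReal_le_ofReal (pow_le_pow_left₀ (norm_nonneg _)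
            (norm_fourier_rlKernelDiff_le hs0 hs1 hh hξ) 2)
        calc _ ≤ ENNReal.ofReal (h ^ (-1 - 2 * s)) * (g ξ *
              ENNReal.ofReal (A ^ 2 * (min 1 (h * |ξ|) * |ξ| ^ (-s)) ^ 2)) := by gcongr
          _ = _ := by
            rw [ENNReal.ofReal_mul (by positivity), ENNReal.ofReal_mul (by positivity)]
            ring
    _ = ∫⁻ ξ, ∫⁻ h in Ioi 0, ENNReal.ofReal (A ^ 2) * g ξ *
        ENNReal.ofReal (h ^ (-1 - 2 * s) * (min 1 (h * |ξ|) * |ξ| ^ (-s)) ^ 2) := by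
        refine lintegral_lintegral_swap (Measurable.aemeasurable ?_)
        have := hgm.comp (measurable_snd : Measurable (Prod.snd : ℝ × ℝ → ℝ))
        simp only [Function.uncurry_def]
        fun_prop
    _ ≤ ∫⁻ ξ, ENNReal.ofReal (A ^ 2) * g ξ *
        ENNReal.ofReal (1 / (2 - 2 * s) + 1 / (2 * s)) := by
        refine lintegral_mono_ae (hne.mono fun ξ hξ => ?_)
        rw [lintegral_const_mul _ (by fun_prop)]
        gcongr
        exact lintegral_rpow_mul_min_sq_le hs0 hs1 (abs_pos.2 hξ)
    _ = _ := by
        rw [lintegral_mul_const _ (by fun_prop), lintegral_const_mul _ hgm,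
          lintegral_enorm_sq_eq_fourier hG, ENNReal.ofReal_mul (by positivity)]
        ring

/-- A lower bound for the symbol of the Gagliardo energy of order `s`. It suffices to integrate over
`h ≤ 1 / (2|t|)`, where Jordan's inequality gives `sin(πh|t|) ≥ 2h|t|`. -/
theorem rpow_le_lintegral_sin_sq {s t : ℝ} (hs1 : s < 1) (ht : t ≠ 0) :
    ENNReal.ofReal (|t| ^ (2 * s)) ≤ ENNReal.ofReal ((2 - 2 * s) / 16 * 2 ^ (2 - 2 * s)) *
      ∫⁻ h in Ioi 0, ENNReal.ofReal (h ^ (-1 - 2 * s)) *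
        ENNReal.ofReal ((2 * |Real.sin (Real.pi * (h * t))|) ^ 2) := by
  have ht' : 0 < |t| := abs_pos.2 ht
  have hs : 0 < 2 - 2 * s := by linarith
  set c : ℝ := 1 / (2 * |t|) with hc
  have hc0 : 0 < c := by positivity
  have key : ∫⁻ h in Ioc 0 c, ENNReal.ofReal (16 * |t| ^ 2) * ENNReal.ofReal (h ^ (1 - 2 * s)) ≤
      ∫⁻ h in Ioi 0, ENNReal.ofReal (h ^ (-1 - 2 * s)) *
        ENNReal.ofReal ((2 * |Real.sin (Real.pi * (h * t))|) ^ 2) := by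
    refine le_trans (setLIntegral_mono' measurableSet_Ioc fun h hh => ?_)
      (lintegral_mono_set Ioc_subset_Ioi_self)
    have h0 : 0 < h := hh.1
    rw [← ENNReal.ofReal_mul (by positivity), ← ENNReal.ofReal_mul (by positivity)]
    refine ENNReal.ofReal_le_ofReal ?_
    have e1 : |Real.sin (Real.pi * (h * t))| = |Real.sin (Real.pi * (h * |t|))| := by
      rcases abs_cases t with ⟨e, _⟩ | ⟨e, _⟩ <;> rw [e]
      rw [mul_neg, mul_neg, Real.sin_neg, abs_neg]
    have hle : h * |t| ≤ 1 / 2 := by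
      have := mul_le_mul_of_nonneg_right hh.2 ht'.le
      rw [hc] at this
      refine this.trans (le_of_eq ?_)
      field_simp
    have e2 : 2 * (h * |t|) ≤ Real.sin (Real.pi * (h * |t|)) := by
      have := Real.mul_le_sin (x := Real.pi * (h * |t|)) (by positivity)
        (by nlinarith [Real.pi_pos])
      refine le_trans (le_of_eq ?_) this
      field_simp
    have e3 : 2 * (h * |t|) ≤ |Real.sin (Real.pi * (h * t))| := by
      rw [e1]
      exact e2.trans (le_abs_self _)
    calc 16 * |t| ^ 2 * h ^ (1 - 2 * s) = h ^ (-1 - 2 * s) * (2 * (2 * (h * |t|))) ^ 2 := by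
          rw [show 1 - 2 * s = -1 - 2 * s + (2 : ℕ) by push_cast; ring, Real.rpow_add h0,
            Real.rpow_natCast]
          ring
      _ ≤ _ := by gcongr
  refine le_trans (le_of_eq ?_) (mul_le_mul_right key _)
  rw [lintegral_const_mul _ (by fun_prop), lintegral_Ioc_rpow (by linarith) hc0,
    ← ENNReal.ofReal_mul (by positivity), ← ENNReal.ofReal_mul (by positivity)]
  congr 1
  rw [hc, one_div, Real.inv_rpow (by positivity), show 1 - 2 * s + 1 = 2 - 2 * s by ring,
    Real.mul_rpow (by norm_num) ht'.le, show 2 * s = (2 : ℕ) - (2 - 2 * s) by push_cast; ring,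
    Real.rpow_sub ht', Real.rpow_natCast]
  have hs' : 1 - s ≠ 0 := by linarith
  rw [show 2 - 2 * s = 2 * (1 - s) by ring]
  field_simp
  ring_nf

theorem lintegral_enorm_sub_comp_sub_sq {F : ℝ → ℝ} (hF : Integrable F) (r : ℝ) :
    ∫⁻ x, ‖F x - F (x - r)‖ₑ ^ 2 =
      ∫⁻ ξ, ENNReal.ofReal ((2 * |Real.sin (Real.pi * (r * ξ))|) ^ 2) *
        ‖𝓕 (fun x => (F x : ℂ)) ξ‖ₑ ^ 2 := by
  rw [lintegral_enorm_sq_eq_fourier (f := fun x => F x - F (x - r))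
    (hF.sub (hF.comp_sub_right r))]
  refine lintegral_congr fun ξ => ?_
  have := fourier_sub_comp_sub (Integrable.ofReal (𝕜 := ℂ) hF) r ξ
  simp only [RCLike.ofReal_eq_complex_ofReal] at this
  simp only [Complex.ofReal_sub]
  rw [this, enorm_mul, mul_pow, enorm_sq_eq_ofReal_norm (1 - _), norm_one_sub_fourierChar]

theorem lintegral_rpow_mul_le_lintegral_sin_sq {s : ℝ} (hs1 : s < 1) {g : ℝ → ℝ≥0∞}
    (hg : Measurable g) :
    ∫⁻ ξ, ENNReal.ofReal (|ξ| ^ (2 * s)) * g ξ ≤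
      ENNReal.ofReal ((2 - 2 * s) / 16 * 2 ^ (2 - 2 * s)) *
        ∫⁻ r in Ioi 0, ENNReal.ofReal (r ^ (-1 - 2 * s)) *
          ∫⁻ ξ, ENNReal.ofReal ((2 * |Real.sin (Real.pi * (r * ξ))|) ^ 2) * g ξ := by
  have hne : ∀ᵐ ξ : ℝ, ξ ≠ 0 := by simp [ae_iff]
  have hm : Measurable fun p : ℝ × ℝ => ENNReal.ofReal (p.1 ^ (-1 - 2 * s)) *
      (ENNReal.ofReal ((2 * |Real.sin (Real.pi * (p.1 * p.2))|) ^ 2) * g p.2) := by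
    have := hg.comp (measurable_snd : Measurable (Prod.snd : ℝ × ℝ → ℝ))
    fun_prop
  have e : ∫⁻ r in Ioi 0, ENNReal.ofReal (r ^ (-1 - 2 * s)) *
        ∫⁻ ξ, ENNReal.ofReal ((2 * |Real.sin (Real.pi * (r * ξ))|) ^ 2) * g ξ =
      ∫⁻ ξ, (∫⁻ r in Ioi 0, ENNReal.ofReal (r ^ (-1 - 2 * s)) *
        ENNReal.ofReal ((2 * |Real.sin (Real.pi * (r * ξ))|) ^ 2)) * g ξ := by
    calc _ = ∫⁻ r in Ioi 0, ∫⁻ ξ, ENNReal.ofReal (r ^ (-1 - 2 * s)) *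
          (ENNReal.ofReal ((2 * |Real.sin (Real.pi * (r * ξ))|) ^ 2) * g ξ) :=
          lintegral_congr fun r => (lintegral_const_mul' _ _ ENNReal.ofReal_ne_top).symm
      _ = ∫⁻ ξ, ∫⁻ r in Ioi 0, ENNReal.ofReal (r ^ (-1 - 2 * s)) *
          (ENNReal.ofReal ((2 * |Real.sin (Real.pi * (r * ξ))|) ^ 2) * g ξ) :=
          lintegral_lintegral_swap hm.aemeasurable
      _ = _ := by
          refine lintegral_congr fun ξ => ?_
          simp only [← mul_assoc]
          exact lintegral_mul_const _ (by fun_prop)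
  rw [e, ← lintegral_const_mul' _ _ ENNReal.ofReal_ne_top]
  refine lintegral_mono_ae (hne.mono fun ξ hξ => ?_)
  rw [← mul_assoc]
  exact mul_le_mul_left (rpow_le_lintegral_sin_sq hs1 hξ) _

theorem lintegral_conv_rlKernelDiff_one_sub_le_fourier {s h : ℝ} (hs0 : 0 < s) (hs1 : s < 1)
    (hh : 0 < h) {F : ℝ → ℝ} (hF : Integrable F) :
    ∫⁻ x, ‖conv F (rlKernelDiff (1 - s) h) x‖ₑ ^ 2 ≤
      ENNReal.ofReal ((8 / ((1 - s) * Real.Gamma (1 - s))) ^ 2 * h ^ 2) *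
        ∫⁻ ξ, ENNReal.ofReal (|ξ| ^ (2 * s)) * ‖𝓕 (fun x => (F x : ℂ)) ξ‖ₑ ^ 2 := by
  have ha0 : 0 < 1 - s := by linarith
  have ha1 : 1 - s < 1 := by linarith
  set A : ℝ := 8 / ((1 - s) * Real.Gamma (1 - s))
  have hA : 0 < A := by have := Real.Gamma_pos_of_pos ha0; positivity
  have hne : ∀ᵐ ξ : ℝ, ξ ≠ 0 := by simp [ae_iff]
  rw [lintegral_enorm_conv_sq hF (integrable_rlKernelDiff ha0 ha1 hh),
    ← lintegral_const_mul' _ _ ENNReal.ofReal_ne_top]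
  refine lintegral_mono_ae (hne.mono fun ξ hξ => ?_)
  have hξ' : 0 < |ξ| := abs_pos.2 hξ
  have h1 : ‖𝓕 (fun z => (rlKernelDiff (1 - s) h z : ℂ)) ξ‖ₑ ^ 2 ≤
      ENNReal.ofReal (A ^ 2 * h ^ 2 * |ξ| ^ (2 * s)) := by
    rw [enorm_sq_eq_ofReal_norm]
    refine ENNReal.ofReal_le_ofReal ((pow_le_pow_left₀ (norm_nonneg _)
      (norm_fourier_rlKernelDiff_le ha0 ha1 hh hξ) 2).trans ?_)
    calc (A * (min 1 (h * |ξ|) * |ξ| ^ (-(1 - s)))) ^ 2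
        ≤ (A * ((h * |ξ|) * |ξ| ^ (-(1 - s)))) ^ 2 := by
          gcongr
          exact min_le_right _ _
      _ = A ^ 2 * h ^ 2 * (|ξ| * |ξ| ^ (-(1 - s))) ^ 2 := by ring
      _ = A ^ 2 * h ^ 2 * |ξ| ^ (2 * s) := by
          congr 1
          nth_rewrite 1 [← Real.rpow_one |ξ|]
          rw [← Real.rpow_add hξ', ← Real.rpow_natCast, ← Real.rpow_mul hξ'.le]
          congr 1
          push_cast
          ring
  calc _ ≤ ‖𝓕 (fun x => (F x : ℂ)) ξ‖ₑ ^ 2 *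
        ENNReal.ofReal (A ^ 2 * h ^ 2 * |ξ| ^ (2 * s)) := mul_le_mul_right h1 _
    _ = _ := by rw [ENNReal.ofReal_mul (by positivity)]; ring

/-- An increment of the Riemann-Liouville integral of order `1 - s` of `F` with step `h` has `L²`
norm at most `C h` times the Gagliardo seminorm of order `s` of `F`. -/
theorem lintegral_conv_rlKernelDiff_one_sub_le {s : ℝ} (hs0 : 0 < s) (hs1 : s < 1) :
    ∃ C : ℝ, 0 < C ∧ ∀ F : ℝ → ℝ, Integrable F → ∀ h : ℝ, 0 < h →
      ∫⁻ x, ‖conv F (rlKernelDiff (1 - s) h) x‖ₑ ^ 2 ≤ ENNReal.ofReal (C * h ^ 2) *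
        ∫⁻ r in Ioi 0, ENNReal.ofReal (r ^ (-1 - 2 * s)) * ∫⁻ x, ‖F x - F (x - r)‖ₑ ^ 2 := by
  have hs2 : 0 < 2 - 2 * s := by linarith
  have hG : 0 < (1 - s) * Real.Gamma (1 - s) :=
    mul_pos (by linarith) (Real.Gamma_pos_of_pos (by linarith))
  refine ⟨(8 / ((1 - s) * Real.Gamma (1 - s))) ^ 2 * ((2 - 2 * s) / 16 * 2 ^ (2 - 2 * s)),
    by positivity, fun F hF h hh => ?_⟩
  have hgm : Measurable fun ξ => ‖𝓕 (fun x => (F x : ℂ)) ξ‖ₑ ^ 2 := by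
    have := (continuous_fourier_ofReal hF).measurable
    fun_prop
  refine (lintegral_conv_rlKernelDiff_one_sub_le_fourier hs0 hs1 hh hF).trans
    ((mul_le_mul_right (lintegral_rpow_mul_le_lintegral_sin_sq hs1 hgm) _).trans (le_of_eq ?_))
  simp only [lintegral_enorm_sub_comp_sub_sq hF]
  rw [← mul_assoc, ← ENNReal.ofReal_mul (by positivity)]
  congr 2
  ring

/-! ### Gagliardo energies as integrals over increments -/

theorem lintegral_lintegral_eq_increments {H : ℝ × ℝ → ℝ≥0∞} (hm : Measurable H)
    (hsymm : ∀ x y, H (x, y) = H (y, x)) :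
    ∫⁻ p, H p ∂((volume : Measure ℝ).prod volume) =
      2 * ∫⁻ h in Ioi 0, ∫⁻ x, H (x, x - h) := by
  have hm2 : Measurable fun p : ℝ × ℝ => H (p.1, p.1 - p.2) :=
    hm.comp (measurable_fst.prodMk (measurable_fst.sub measurable_snd))
  have hm3 : Measurable fun h : ℝ => ∫⁻ x, H (x, x - h) :=
    (hm2.comp measurable_swap).lintegral_prod_right'
  have e1 : ∫⁻ p, H p ∂((volume : Measure ℝ).prod volume) = ∫⁻ h, ∫⁻ x, H (x, x - h) := by
    rw [lintegral_prod _ hm.aemeasurable]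
    calc _ = ∫⁻ x, ∫⁻ h, H (x, x - h) :=
          lintegral_congr fun x => (lintegral_sub_left_eq_self (fun y => H (x, y)) x).symm
      _ = _ := lintegral_lintegral_swap hm2.aemeasurable
  have e2 : ∫⁻ h in Iic 0, ∫⁻ x, H (x, x - h) = ∫⁻ h in Ioi 0, ∫⁻ x, H (x, x - h) := by
    have hmp := (Measure.measurePreserving_neg (volume : Measure ℝ)).restrict_preimage
      (s := Iio 0) measurableSet_Iio
    rw [setLIntegral_congr Iio_ae_eq_Iic.symm, ← hmp.lintegral_comp hm3]
    simp only [neg_preimage, neg_Iio, neg_zero, sub_neg_eq_add]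
    refine lintegral_congr fun h => ?_
    rw [← lintegral_add_right_eq_self (fun x => H (x, x - h)) h]
    simp only [add_sub_cancel_right]
    exact lintegral_congr fun x => hsymm _ _
  rw [e1, ← lintegral_add_compl _ (measurableSet_Iic (a := (0 : ℝ))), compl_Iic, e2, two_mul]

theorem enorm_diffQuot_sq {s h : ℝ} (hh : 0 < h) (f : ℝ → ℝ) (x : ℝ) :
    ‖diffQuot s f (x, x - h)‖ₑ ^ 2 =
      ENNReal.ofReal (h ^ (-1 - 2 * s)) * ‖f x - f (x - h)‖ₑ ^ 2 := by
  rw [enorm_sq_eq_ofReal, enorm_sq_eq_ofReal, ← ENNReal.ofReal_mul (by positivity)]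
  congr 1
  simp only [diffQuot]
  rw [show x - (x - h) = h by ring, abs_of_pos hh, div_pow,
    show (-1 - 2 * s) = -((1 / 2 + s) * (2 : ℕ)) by push_cast; ring, Real.rpow_neg hh.le,
    Real.rpow_mul hh.le, Real.rpow_natCast, div_eq_inv_mul]

theorem diffQuot_swap (s : ℝ) (f : ℝ → ℝ) (x y : ℝ) :
    ‖diffQuot s f (x, y)‖ₑ = ‖diffQuot s f (y, x)‖ₑ := by
  simp only [diffQuot]
  rw [abs_sub_comm, ← neg_sub (f y), neg_div, enorm_neg]

theorem measurable_diffQuot {s : ℝ} {f : ℝ → ℝ} (hf : Measurable f) :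
    Measurable (diffQuot s f) := by
  unfold diffQuot
  fun_prop

theorem eLpNorm_two_sq {X : Type*} [MeasurableSpace X] (μ : Measure X) (f : X → ℝ) :
    eLpNorm f 2 μ ^ 2 = ∫⁻ x, ‖f x‖ₑ ^ 2 ∂μ := by
  rw [eLpNorm_eq_lintegral_rpow_enorm_toReal (by norm_num) (by norm_num),
    ← ENNReal.rpow_natCast, ← ENNReal.rpow_mul]
  simp

theorem lintegral_diffQuot_univ (s : ℝ) {f : ℝ → ℝ} (hf : Measurable f) :
    ∫⁻ p, ‖diffQuot s f p‖ₑ ^ 2 ∂((volume : Measure ℝ).prod volume) =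
      2 * ∫⁻ h in Ioi 0, ENNReal.ofReal (h ^ (-1 - 2 * s)) * ∫⁻ x, ‖f x - f (x - h)‖ₑ ^ 2 := by
  have := measurable_diffQuot (s := s) hf
  rw [lintegral_lintegral_eq_increments (by fun_prop) (fun x y => by rw [diffQuot_swap])]
  congr 1
  refine setLIntegral_congr_fun measurableSet_Ioi fun h hh => ?_
  rw [← lintegral_const_mul' _ _ ENNReal.ofReal_ne_top]
  exact lintegral_congr fun x => enorm_diffQuot_sq hh f x

/-- To bound the Gagliardo energy on the half-line `(-∞,1)`, it suffices to know functions on the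
whole line which agree there with the increments of `f`. -/
theorem lintegral_diffQuot_Iio_le (s : ℝ) {f : ℝ → ℝ} (hf : Measurable f) {d : ℝ → ℝ → ℝ}
    (hd : ∀ h, 0 < h → ∀ x < 1, f x - f (x - h) = d h x) :
    ∫⁻ p, ‖diffQuot s f p‖ₑ ^ 2 ∂((volume.restrict (Iio (1 : ℝ))).prod
        (volume.restrict (Iio (1 : ℝ)))) ≤
      2 * ∫⁻ h in Ioi 0, ENNReal.ofReal (h ^ (-1 - 2 * s)) * ∫⁻ x, ‖d h x‖ₑ ^ 2 := by
  have hq := measurable_diffQuot (s := s) hf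
  have hms : MeasurableSet (Iio (1 : ℝ) ×ˢ Iio (1 : ℝ)) := measurableSet_Iio.prod measurableSet_Iio
  rw [Measure.prod_restrict, ← lintegral_indicator hms, lintegral_lintegral_eq_increments]
  · gcongr 2 * ?_
    refine setLIntegral_mono' measurableSet_Ioi fun h hh => ?_
    rw [← lintegral_const_mul' _ _ ENNReal.ofReal_ne_top]
    refine lintegral_mono fun x => ?_
    by_cases hx : x < 1
    · rw [indicator_of_mem (by
        have : 0 < h := hh
        exact ⟨hx, by simp only [mem_Iio]; linarith⟩), enorm_diffQuot_sq hh, hd h hh x hx]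
    · rw [indicator_of_notMem (fun hm => hx hm.1)]
      exact zero_le
  · exact Measurable.indicator (by fun_prop) hms
  · intro x y
    by_cases hx : x < 1 <;> by_cases hy : y < 1 <;> simp [indicator, hx, hy, diffQuot_swap s f x y]

/-! ### Even reflection about the right end point -/

/-- The extension of a function from `(-∞,1)` to the line by even reflection about `1`. -/
def reflectOne (u : ℝ → ℝ) (x : ℝ) : ℝ := u (min x (2 - x))

theorem measurable_reflectOne {u : ℝ → ℝ} (hu : Measurable u) : Measurable (reflectOne u) :=
  hu.comp (by fun_prop)

theorem lintegral_comp_min_two_sub {H : ℝ → ℝ≥0∞} (hH : Measurable H) :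
    ∫⁻ x, H (min x (2 - x)) = 2 * ∫⁻ x in Iio 1, H x := by
  have e1 : ∫⁻ x in Iio 1, H (min x (2 - x)) = ∫⁻ x in Iio 1, H x :=
    setLIntegral_congr_fun measurableSet_Iio fun x hx => by
      have hx' : x < 1 := hx
      rw [min_eq_left (by linarith)]
  have e2 : ∫⁻ x in Ici 1, H (min x (2 - x)) = ∫⁻ x in Iio 1, H x := by
    have hmp := (Measure.measurePreserving_sub_left (volume : Measure ℝ) 2).restrict_preimage
      (s := Iic 1) measurableSet_Iic
    rw [setLIntegral_congr Iio_ae_eq_Iic, ← hmp.lintegral_comp hH]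
    have : (fun x : ℝ => 2 - x) ⁻¹' Iic 1 = Ici 1 := by
      ext x; simp only [mem_preimage, mem_Iic, mem_Ici]; constructor <;> intro h <;> linarith
    rw [this]
    refine setLIntegral_congr_fun measurableSet_Ici fun x hx => ?_
    have hx' : 1 ≤ x := hx
    rw [min_eq_right (by linarith)]
  rw [← lintegral_add_compl _ (measurableSet_Iio (a := (1 : ℝ))), compl_Iio, e1, e2, two_mul]

theorem lintegral_reflectOne_sq {u : ℝ → ℝ} (hu : Measurable u) :
    ∫⁻ x, ‖reflectOne u x‖ₑ ^ 2 = 2 * ∫⁻ x in Iio 1, ‖u x‖ₑ ^ 2 :=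
  lintegral_comp_min_two_sub (H := fun x => ‖u x‖ₑ ^ 2) (by fun_prop)

theorem abs_min_two_sub_sub_le (x y : ℝ) : |min x (2 - x) - min y (2 - y)| ≤ |x - y| := by
  refine (abs_min_sub_min_le_max x (2 - x) y (2 - y)).trans (max_le le_rfl ?_)
  rw [show 2 - x - (2 - y) = -(x - y) by ring, abs_neg]

theorem enorm_diffQuot_reflectOne_le {s : ℝ} (hs : 0 < s) (u : ℝ → ℝ) (x y : ℝ) :
    ‖diffQuot s (reflectOne u) (x, y)‖ₑ ≤
      ‖diffQuot s u (min x (2 - x), min y (2 - y))‖ₑ := by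
  rw [Real.enorm_eq_ofReal_abs, Real.enorm_eq_ofReal_abs]
  refine ENNReal.ofReal_le_ofReal ?_
  simp only [diffQuot, reflectOne, abs_div]
  -- If `x` and `y` have the same reflection, the numerators vanish and both sides are `0`.
  rcases eq_or_ne (min x (2 - x)) (min y (2 - y)) with h | h
  · simp [h]
  · have h0 : 0 < |min x (2 - x) - min y (2 - y)| := abs_pos.2 (sub_ne_zero.2 h)
    rw [abs_of_nonneg (Real.rpow_nonneg (abs_nonneg _) _),
      abs_of_nonneg (Real.rpow_nonneg (abs_nonneg (min x (2 - x) - min y (2 - y))) _)]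
    refine div_le_div_of_nonneg_left (abs_nonneg _) (Real.rpow_pos_of_pos h0 _) ?_
    exact Real.rpow_le_rpow h0.le (abs_min_two_sub_sub_le x y) (by linarith)

/-- Reflection is a contraction of the line, so each of the four quadrants contributes at most the
energy on the half-line. -/
theorem lintegral_diffQuot_reflectOne_le {s : ℝ} (hs : 0 < s) {u : ℝ → ℝ} (hu : Measurable u) :
    ∫⁻ p, ‖diffQuot s (reflectOne u) p‖ₑ ^ 2 ∂((volume : Measure ℝ).prod volume) ≤
      4 * ∫⁻ p, ‖diffQuot s u p‖ₑ ^ 2 ∂((volume.restrict (Iio (1 : ℝ))).prod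
        (volume.restrict (Iio (1 : ℝ)))) := by
  have hq := measurable_diffQuot (s := s) hu
  have hq2 := measurable_diffQuot (s := s) (measurable_reflectOne hu)
  have hH : Measurable fun p => ‖diffQuot s u p‖ₑ ^ 2 := by fun_prop
  rw [lintegral_prod _ (by fun_prop), lintegral_prod _ (by fun_prop)]
  calc _ ≤ ∫⁻ x, ∫⁻ y, ‖diffQuot s u (min x (2 - x), min y (2 - y))‖ₑ ^ 2 := by
        gcongr with x y
        exact enorm_diffQuot_reflectOne_le hs u x y
    _ = ∫⁻ x, 2 * ∫⁻ y in Iio 1, ‖diffQuot s u (min x (2 - x), y)‖ₑ ^ 2 := by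
        refine lintegral_congr fun x => ?_
        exact lintegral_comp_min_two_sub
          (H := fun y => ‖diffQuot s u (min x (2 - x), y)‖ₑ ^ 2) (by fun_prop)
    _ = 2 * ∫⁻ x in Iio 1, 2 * ∫⁻ y in Iio 1, ‖diffQuot s u (x, y)‖ₑ ^ 2 :=
        lintegral_comp_min_two_sub
          (H := fun x => 2 * ∫⁻ y in Iio 1, ‖diffQuot s u (x, y)‖ₑ ^ 2)
          (Measurable.const_mul hH.lintegral_prod_right' 2)
    _ = _ := by
        rw [lintegral_const_mul' _ _ (by norm_num), ← mul_assoc]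
        norm_num

/-! ### Convolution with the truncated kernel -/

/-- The kernel of the Riemann-Liouville integral of order `a`, truncated to `(0,1)` to make it
integrable. At points `x ≤ 1` the truncation does not change the convolution with a function
supported in `(0,∞)`. -/
def unitKernel (a : ℝ) : ℝ → ℝ := (Ioo 0 1).indicator fun z => z ^ (a - 1) / Real.Gamma a

theorem measurable_unitKernel (a : ℝ) : Measurable (unitKernel a) :=
  Measurable.indicator (by fun_prop) measurableSet_Ioo

theorem unitKernel_of_lt_one {a z : ℝ} (hz : z < 1) : unitKernel a z = rlKernel a z := by
  by_cases h : 0 < z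
  · rw [rlKernel_of_pos h, unitKernel, indicator_of_mem (mem_Ioo.2 ⟨h, hz⟩)]
  · rw [rlKernel_of_nonpos (not_lt.1 h), unitKernel, indicator_of_notMem fun hm => h hm.1]

theorem integrable_unitKernel {a : ℝ} (ha : 0 < a) : Integrable (unitKernel a) := by
  rw [unitKernel, integrable_indicator_iff measurableSet_Ioo]
  exact ((integrableOn_Ioc_rpow ha one_pos).mono_set Ioo_subset_Ioc_self).div_const _

theorem memLp_unitKernel {a : ℝ} (ha : 1 / 2 < a) : MemLp (unitKernel a) 2 := by
  rw [memLp_two_iff_integrable_sq (measurable_unitKernel a).aestronglyMeasurable]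
  have e : (fun z => unitKernel a z ^ 2) =
      (Ioo 0 1).indicator fun z : ℝ => z ^ ((2 * a - 1) - 1) / Real.Gamma a ^ 2 := by
    funext z
    by_cases hz : z ∈ Ioo (0 : ℝ) 1
    · rw [unitKernel, indicator_of_mem hz, indicator_of_mem hz, div_pow, ← Real.rpow_natCast,
        ← Real.rpow_mul hz.1.le]
      congr 2
      push_cast
      ring
    · rw [unitKernel, indicator_of_notMem hz, indicator_of_notMem hz, zero_pow two_ne_zero]
  rw [e, integrable_indicator_iff measurableSet_Ioo]
  exact ((integrableOn_Ioc_rpow (a := 2 * a - 1) (by linarith) one_pos).mono_set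
    Ioo_subset_Ioc_self).div_const _

theorem conv_integrand_unitKernel {f : ℝ → ℝ} (hf : ∀ t ≤ 0, f t = 0) {x : ℝ} (hx : x ≤ 1)
    (a t : ℝ) : f t * unitKernel a (x - t) = f t * rlKernel a (x - t) := by
  rcases le_or_gt t 0 with ht | ht
  · rw [hf t ht, zero_mul, zero_mul]
  · rw [unitKernel_of_lt_one (by linarith)]

theorem conv_unitKernel_of_nonpos {f : ℝ → ℝ} (hf : ∀ t ≤ 0, f t = 0) {x : ℝ} (hx : x ≤ 0)
    (a : ℝ) : conv f (unitKernel a) x = 0 := by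
  rw [conv_apply]
  refine integral_eq_zero_of_ae (Eventually.of_forall fun t => ?_)
  dsimp only [Pi.zero_apply]
  rcases le_or_gt t 0 with ht | ht
  · rw [hf t ht, zero_mul]
  · rw [unitKernel, indicator_of_notMem fun hm => by linarith [hm.1], mul_zero]

/-- On `(-∞,1]` the increments are convolutions with increments of the untruncated kernel, which
have a good Fourier transform. -/
theorem conv_unitKernel_sub {f : ℝ → ℝ} (hf : ∀ t ≤ 0, f t = 0) {a x h : ℝ} (hx : x ≤ 1)
    (hh : 0 < h) (h1 : Integrable fun t => f t * unitKernel a (x - t))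
    (h2 : Integrable fun t => f t * unitKernel a (x - h - t)) :
    conv f (unitKernel a) x - conv f (unitKernel a) (x - h) = conv f (rlKernelDiff a h) x := by
  rw [conv_apply, conv_apply, conv_apply, ← integral_sub h1 h2]
  refine integral_congr_ae (Eventually.of_forall fun t => ?_)
  dsimp only
  rw [conv_integrand_unitKernel hf hx, conv_integrand_unitKernel hf (by linarith), ← mul_sub,
    rlKernelDiff, show x - h - t = x - t - h by ring]

theorem rlIntegral_eq_conv {a x : ℝ} (hx : x ∈ Ioc (0 : ℝ) 1) (u : ℝ → ℝ) :
    rlIntegral a u x = conv (zeroExt u) (unitKernel a) x := by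
  rw [rlIntegral, conv_apply, intervalIntegral.integral_of_le hx.1.le, ← integral_const_mul,
    integral_Ioc_eq_integral_Ioo,
    ← integral_indicator measurableSet_Ioo]
  refine integral_congr_ae (Eventually.of_forall fun t => ?_)
  dsimp only
  by_cases ht : t ∈ Ioo 0 x
  · rw [indicator_of_mem ht, zeroExt, indicator_of_mem (mem_Ioo.2 ⟨ht.1, ht.2.trans_le hx.2⟩),
      unitKernel, indicator_of_mem (mem_Ioo.2 ⟨by linarith [ht.2], by linarith [ht.1, hx.2]⟩)]
    ring
  · rw [indicator_of_notMem ht]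
    by_cases h0 : 0 < t
    · rw [unitKernel, indicator_of_notMem fun hm => ht ⟨h0, by linarith [hm.1]⟩, mul_zero]
    · rw [zeroExt, indicator_of_notMem fun hm => h0 hm.1, zero_mul]

theorem zeroExt_of_nonpos (u : ℝ → ℝ) : ∀ t ≤ 0, zeroExt u t = 0 := fun t ht =>
  indicator_of_notMem (fun hm => by linarith [hm.1]) _

theorem zeroExt_of_mem {u : ℝ → ℝ} {x : ℝ} (hx : x ∈ Ioo (0 : ℝ) 1) : zeroExt u x = u x :=
  indicator_of_mem hx _

theorem measurable_zeroExt (u : L2D) : Measurable (zeroExt u) :=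
  (Lp.stronglyMeasurable u).measurable.indicator measurableSet_Ioo

theorem memLp_zeroExt (u : L2D) : MemLp (zeroExt u) 2 :=
  (memLp_indicator_iff_restrict measurableSet_Ioo).2 (Lp.memLp u)

theorem integrable_zeroExt (u : L2D) : Integrable (zeroExt u) :=
  (integrable_indicator_iff measurableSet_Ioo).2 ((Lp.memLp u).integrable (by norm_num))

theorem eLpNorm_zeroExt (u : L2D) : eLpNorm (zeroExt u) 2 volume = ‖u‖ₑ := by
  rw [zeroExt, eLpNorm_indicator_eq_eLpNorm_restrict measurableSet_Ioo, Lp.enorm_def]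

/-! ### Convolution of square integrable functions -/

theorem integrable_conv_integrand {f k : ℝ → ℝ} (hf : MemLp f 2) (hk : MemLp k 2) (x : ℝ) :
    Integrable fun t => f t * k (x - t) :=
  hf.integrable_mul (hk.comp_measurePreserving (Measure.measurePreserving_sub_left volume x))

theorem conv_eq_inner {f k : ℝ → ℝ} (hf : MemLp f 2) (hk : MemLp k 2) (x : ℝ) :
    conv f k x = inner ℝ (Lp.compMeasurePreserving (fun t => x - t)
      (Measure.measurePreserving_sub_left volume x) (hk.toLp k)) (hf.toLp f) := by
  rw [conv_apply, L2.inner_def]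
  refine integral_congr_ae ?_
  have h1 := Lp.coeFn_compMeasurePreserving (hk.toLp k)
    (Measure.measurePreserving_sub_left volume x)
  have h2 := (Measure.measurePreserving_sub_left volume x).quasiMeasurePreserving.ae_eq_comp
    hk.coeFn_toLp
  filter_upwards [h1, h2, hf.coeFn_toLp] with t e1 e2 e3
  rw [e1, e2, e3]
  simp

/-- The convolution is an inner product with a reflected translate, and translation is continuous
in `L²`. -/
theorem continuous_conv {f k : ℝ → ℝ} (hf : MemLp f 2) (hk : MemLp k 2) :
    Continuous (conv f k) := by
  have e : conv f k = fun x => inner ℝ (Lp.compMeasurePreserving (fun t => x - t)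
      (Measure.measurePreserving_sub_left volume x) (hk.toLp k)) (hf.toLp f) :=
    funext fun x => conv_eq_inner hf hk x
  rw [e]
  refine Continuous.inner ?_ continuous_const
  have hc : Continuous fun x : ℝ => (⟨fun t : ℝ => x - t, by fun_prop⟩ : C(ℝ, ℝ)) :=
    ContinuousMap.continuous_of_continuous_uncurry _
      (by exact continuous_fst.sub continuous_snd)
  exact Continuous.compMeasurePreservingLp (continuous_const (y := hk.toLp k)) hc
    (fun x => Measure.measurePreserving_sub_left volume x) (by norm_num)

theorem abs_conv_le {f k : ℝ → ℝ} (hf : MemLp f 2) (hk : MemLp k 2) (x : ℝ) :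
    |conv f k x| ≤ (eLpNorm k 2 volume).toReal * (eLpNorm f 2 volume).toReal := by
  rw [conv_eq_inner hf hk]
  refine (abs_real_inner_le_norm _ _).trans (le_of_eq ?_)
  rw [Lp.norm_compMeasurePreserving, Lp.norm_toLp, Lp.norm_toLp]

/-! ### The semigroup property -/

theorem ae_conv_assoc {f g k : ℝ → ℝ} (hf : Integrable f) (hg : Integrable g)
    (hk : Integrable k) : ∀ᵐ x, conv (conv f g) k x = conv f (conv g k) x := by
  have h := hf.norm.ae_convolution_exists (ContinuousLinearMap.mul ℝ ℝ)
    (hg.norm.integrable_convolution (ContinuousLinearMap.mul ℝ ℝ) hk.norm)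
  filter_upwards [h] with x hx
  exact convolution_assoc _ _ _ _ (fun a b c => mul_assoc a b c) hf.aestronglyMeasurable
    hg.aestronglyMeasurable hk.aestronglyMeasurable (hf.ae_convolution_exists _ hg)
    (hg.norm.ae_convolution_exists _ hk.norm) hx

theorem integral_rpow_mul_sub_rpow {a b z : ℝ} (ha : 0 < a) (hb : 0 < b) (hab : a + b = 1)
    (hz : 0 < z) :
    ∫ y in (0 : ℝ)..z, y ^ (a - 1) * (z - y) ^ (b - 1) = Real.Gamma a * Real.Gamma b := by
  have h1 := Complex.betaIntegral_scaled a b hz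
  have h2 := Complex.Gamma_mul_Gamma_eq_betaIntegral (s := a) (t := b) (by simpa) (by simpa)
  have hab' : (a : ℂ) + b = 1 := by exact_mod_cast hab
  rw [hab', Complex.Gamma_one, one_mul] at h2
  rw [hab', sub_self, Complex.cpow_zero, one_mul, ← h2, Complex.Gamma_ofReal,
    Complex.Gamma_ofReal] at h1
  apply Complex.ofReal_injective
  rw [← intervalIntegral.integral_ofReal, Complex.ofReal_mul, ← h1]
  refine intervalIntegral.integral_congr fun y hy => ?_
  rw [uIcc_of_le hz.le] at hy
  rw [Complex.ofReal_mul, Complex.ofReal_cpow hy.1, Complex.ofReal_cpow (by linarith [hy.2])]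
  push_cast
  rfl

theorem conv_unitKernel_unitKernel {a b z : ℝ} (ha : 0 < a) (hb : 0 < b) (hab : a + b = 1)
    (hz0 : 0 < z) (hz1 : z < 1) : conv (unitKernel a) (unitKernel b) z = 1 := by
  have hga := (Real.Gamma_pos_of_pos ha).ne'
  have hgb := (Real.Gamma_pos_of_pos hb).ne'
  have e : ∀ t, unitKernel a t * unitKernel b (z - t) = (Ioo 0 z).indicator
      (fun t => t ^ (a - 1) * (z - t) ^ (b - 1) / (Real.Gamma a * Real.Gamma b)) t := by
    intro t
    by_cases ht : t ∈ Ioo 0 z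
    · rw [indicator_of_mem ht, unitKernel, unitKernel,
        indicator_of_mem (mem_Ioo.2 ⟨ht.1, ht.2.trans hz1⟩),
        indicator_of_mem (mem_Ioo.2 ⟨by linarith [ht.2], by linarith [ht.1]⟩)]
      field_simp
    · rw [indicator_of_notMem ht]
      by_cases h0 : 0 < t
      · rw [unitKernel, unitKernel, indicator_of_notMem (a := z - t)
          fun hm => ht ⟨h0, by linarith [hm.1]⟩, mul_zero]
      · rw [unitKernel, indicator_of_notMem fun hm => h0 hm.1, zero_mul]
  rw [conv_apply]
  simp only [e]
  rw [integral_indicator measurableSet_Ioo, integral_div, ← integral_Ioc_eq_integral_Ioo,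
    ← intervalIntegral.integral_of_le hz0.le, integral_rpow_mul_sub_rpow ha hb hab hz0, div_self]
  exact mul_ne_zero hga hgb

/-- Riemann-Liouville integrals of complementary orders compose to the ordinary integral. -/
theorem ae_conv_conv_unitKernel {a b : ℝ} (ha : 0 < a) (hb : 0 < b) (hab : a + b = 1)
    {f : ℝ → ℝ} (hf : Integrable f) (hf0 : ∀ t ≤ 0, f t = 0) :
    ∀ᵐ x, x ≤ 1 → conv (conv f (unitKernel a)) (unitKernel b) x = ∫ t in Iio x, f t := by
  filter_upwards [ae_conv_assoc hf (integrable_unitKernel ha) (integrable_unitKernel hb)]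
    with x hx hx1
  rw [hx, conv_apply, ← integral_indicator measurableSet_Iio]
  refine integral_congr_ae (Eventually.of_forall fun t => ?_)
  dsimp only
  rcases le_or_gt t 0 with ht | ht
  · rw [hf0 t ht, zero_mul]
    exact (indicator_apply_eq_zero.2 fun _ => hf0 t ht).symm
  · by_cases htx : t < x
    · rw [indicator_of_mem (by exact htx), conv_unitKernel_unitKernel ha hb hab (by linarith)
        (by linarith), mul_one]
    · rw [indicator_of_notMem (by exact htx), conv_unitKernel_of_nonpos _ (by linarith), mul_zero]
      intro t ht
      exact indicator_of_notMem (fun hm => by linarith [hm.1]) _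

/-! ### Weak derivatives and primitives -/

/-- The functions of class `C¹` on the line that vanish on `[1,∞)`. There is no condition at `0`:
testing a weak derivative with these functions also encodes a zero boundary value at `0`. -/
def rightTest : Submodule ℝ (ℝ → ℝ) where
  carrier := {ψ | ContDiff ℝ 1 ψ ∧ ∀ x, 1 ≤ x → ψ x = 0}
  add_mem' := fun hf hg => ⟨hf.1.add hg.1, fun x hx => by simp [hf.2 x hx, hg.2 x hx]⟩
  zero_mem' := ⟨contDiff_const, fun _ _ => rfl⟩
  smul_mem' := fun c f hf => ⟨contDiff_const.smul hf.1, fun x hx => by simp [hf.2 x hx]⟩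

theorem exists_abs_le_of_continuous {θ : ℝ → ℝ} (hθ : Continuous θ) (a b : ℝ) :
    ∃ M, 0 ≤ M ∧ ∀ x ∈ Icc a b, |θ x| ≤ M := by
  obtain ⟨M, hM⟩ := isCompact_Icc.exists_bound_of_continuousOn (s := Icc a b) hθ.continuousOn
  exact ⟨max M 0, le_max_right _ _, fun x hx => (hM x hx).trans (le_max_left _ _)⟩

theorem integrableOn_Ioo_mul_continuous {f θ : ℝ → ℝ} (hf : IntegrableOn f (Ioo 0 1))
    (hθ : Continuous θ) : IntegrableOn (fun x => f x * θ x) (Ioo 0 1) := by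
  obtain ⟨M, -, hM⟩ := exists_abs_le_of_continuous hθ 0 1
  refine Integrable.mul_bdd (c := M) hf hθ.aestronglyMeasurable ?_
  filter_upwards [ae_restrict_mem measurableSet_Ioo] with x hx
  exact hM x ⟨hx.1.le, hx.2.le⟩

theorem memLp_volD_of_continuous {θ : ℝ → ℝ} (hθ : Continuous θ) : MemLp θ 2 volD := by
  obtain ⟨M, -, hM⟩ := exists_abs_le_of_continuous hθ 0 1
  refine MemLp.of_bound hθ.aestronglyMeasurable M ?_
  filter_upwards [ae_restrict_mem measurableSet_Ioo] with x hx
  exact hM x ⟨hx.1.le, hx.2.le⟩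

theorem integrableOn_L2D (g : L2D) : IntegrableOn g (Ioo 0 1) :=
  (Lp.memLp g).integrable (by norm_num)

/-- Integration by parts for the primitive `∫_0^x g`. There is no boundary term: the primitive
vanishes at `0` and `ψ` vanishes at `1`. -/
theorem setIntegral_primitive_mul_deriv {g ψ : ℝ → ℝ} (hg : Integrable g)
    (hg0 : ∀ t ≤ 0, g t = 0) (hψ : ψ ∈ rightTest) :
    ∫ x in Ioo (0 : ℝ) 1, (∫ t in Iio x, g t) * deriv ψ x = -∫ x in Ioo (0 : ℝ) 1, g x * ψ x := by
  have hdc : Continuous (deriv ψ) := hψ.1.continuous_deriv le_rfl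
  have hint : Integrable (Function.uncurry fun x t : ℝ => (Iio x).indicator g t * deriv ψ x)
      ((volume.restrict (Ioo (0 : ℝ) 1)).prod volume) := by
    have hd : IntegrableOn (deriv ψ) (Ioo 0 1) :=
      (hdc.integrableOn_Icc).mono_set Ioo_subset_Icc_self
    have h1 := (Integrable.mul_prod hd hg)
    have hs : MeasurableSet {p : ℝ × ℝ | p.2 < p.1} :=
      measurableSet_lt measurable_snd measurable_fst
    refine (h1.indicator hs).congr (Eventually.of_forall fun p => ?_)
    by_cases hp : p.2 < p.1
    · simp [indicator, hp, Function.uncurry, mul_comm]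
    · simp [indicator, hp, Function.uncurry]
  calc _ = ∫ x in Ioo (0 : ℝ) 1, ∫ t, (Iio x).indicator g t * deriv ψ x := by
        refine integral_congr_ae (Eventually.of_forall fun x => ?_)
        dsimp only
        rw [integral_mul_const, integral_indicator measurableSet_Iio]
    _ = ∫ t, ∫ x in Ioo (0 : ℝ) 1, (Iio x).indicator g t * deriv ψ x := integral_integral_swap hint
    _ = ∫ t, (Ioo (0 : ℝ) 1).indicator (fun t => -(g t * ψ t)) t := by
        refine integral_congr_ae (Eventually.of_forall fun t => ?_)
        dsimp only
        by_cases ht0 : 0 < t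
        · by_cases ht1 : t < 1
          · rw [indicator_of_mem (mem_Ioo.2 ⟨ht0, ht1⟩)]
            have e : ∀ x ∈ Ioo (0 : ℝ) 1, (Iio x).indicator g t * deriv ψ x =
                (Ioo t 1).indicator (fun x => g t * deriv ψ x) x := by
              intro x hx
              by_cases htx : t < x
              · rw [indicator_of_mem (by exact htx), indicator_of_mem (mem_Ioo.2 ⟨htx, hx.2⟩)]
              · rw [indicator_of_notMem (by exact htx), zero_mul,
                  indicator_of_notMem fun hm => htx hm.1]
            rw [setIntegral_congr_fun measurableSet_Ioo e, setIntegral_indicator measurableSet_Ioo,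
              inter_eq_right.2 (Ioo_subset_Ioo_left ht0.le), integral_const_mul,
              ← integral_Ioc_eq_integral_Ioo, ← intervalIntegral.integral_of_le ht1.le,
              intervalIntegral.integral_deriv_eq_sub
                (fun x _ => (hψ.1.differentiable one_ne_zero).differentiableAt)
                (hdc.intervalIntegrable _ _), hψ.2 1 le_rfl]
            ring
          · rw [indicator_of_notMem fun hm => ht1 hm.2]
            refine (setIntegral_congr_fun (g := fun _ => (0 : ℝ)) measurableSet_Ioo
              fun x hx => ?_).trans (by simp)
            dsimp only
            rw [indicator_of_notMem (fun hm : t ∈ Iio x => ht1 (lt_trans hm hx.2)), zero_mul]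
        · rw [indicator_of_notMem fun hm => ht0 hm.1]
          refine (setIntegral_congr_fun (g := fun _ => (0 : ℝ)) measurableSet_Ioo
            fun x hx => ?_).trans (by simp)
          dsimp only
          rw [indicator_apply_eq_zero.2 fun _ => hg0 t (not_lt.1 ht0), zero_mul]
    _ = _ := by rw [integral_indicator measurableSet_Ioo, integral_neg]

theorem mem_rightTest_of_tsupport_subset {ψ : ℝ → ℝ} (hψ : ContDiff ℝ (⊤ : ℕ∞) ψ)
    (hs : tsupport ψ ⊆ Ioo 0 1) : ψ ∈ rightTest :=
  ⟨hψ.of_le (by exact_mod_cast le_top), fun x hx =>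
    image_eq_zero_of_notMem_tsupport fun hm => absurd (hs hm).2 (not_lt.2 hx)⟩

theorem ae_eq_zero_of_setIntegral_mul_test {f : ℝ → ℝ} (hf : IntegrableOn f (Ioo 0 1))
    (h : ∀ ψ : ℝ → ℝ, ContDiff ℝ (⊤ : ℕ∞) ψ → HasCompactSupport ψ → tsupport ψ ⊆ Ioo 0 1 →
      ∫ x in Ioo (0 : ℝ) 1, f x * ψ x = 0) : ∀ᵐ x, x ∈ Ioo (0 : ℝ) 1 → f x = 0 := by
  refine isOpen_Ioo.ae_eq_zero_of_integral_contDiff_smul_eq_zero hf.locallyIntegrableOn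
    fun ψ h1 h2 h3 => ?_
  rw [← h ψ h1 h2 h3, ← integral_indicator measurableSet_Ioo]
  refine integral_congr_ae (Eventually.of_forall fun x => ?_)
  dsimp only
  by_cases hx : x ∈ Ioo (0 : ℝ) 1
  · rw [indicator_of_mem hx, smul_eq_mul, mul_comm]
  · rw [indicator_of_notMem hx, image_eq_zero_of_notMem_tsupport fun hm => hx (h3 hm), zero_smul]

theorem IsRLDeriv.unique {β : ℝ} {u g g' : L2D} (h : IsRLDeriv β u g) (h' : IsRLDeriv β u g') :
    g = g' := by
  have key := ae_eq_zero_of_setIntegral_mul_test (f := fun x => g x - g' x)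
    ((integrableOn_L2D g).sub (integrableOn_L2D g')) fun ψ h1 h2 h3 => by
      have e := (h.2.2 ψ h1 h2 h3).symm.trans (h'.2.2 ψ h1 h2 h3)
      simp only [sub_mul]
      rw [integral_sub (integrableOn_Ioo_mul_continuous (integrableOn_L2D g) h1.continuous)
        (integrableOn_Ioo_mul_continuous (integrableOn_L2D g') h1.continuous), neg_inj.1 e,
        sub_self]
  refine Lp.ext ((ae_restrict_iff' measurableSet_Ioo).2 ?_)
  filter_upwards [key] with x hx hx'
  exact sub_eq_zero.1 (hx hx')

theorem ae_eq_zero_of_ae_primitive_eq_zero {e : ℝ → ℝ} (he : Integrable e)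
    (he0 : ∀ t ≤ 0, e t = 0) (h : ∀ᵐ x, x ∈ Ioo (0 : ℝ) 1 → ∫ t in Iio x, e t = 0) :
    ∀ᵐ x, x ∈ Ioo (0 : ℝ) 1 → e x = 0 := by
  refine ae_eq_zero_of_setIntegral_mul_test he.integrableOn fun ψ h1 h2 h3 => ?_
  have e1 := setIntegral_primitive_mul_deriv he he0 (mem_rightTest_of_tsupport_subset h1 h3)
  rw [← neg_eq_zero, ← e1]
  refine integral_eq_zero_of_ae ((ae_restrict_iff' measurableSet_Ioo).2 ?_)
  filter_upwards [h] with x hx hx'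
  rw [hx hx', zero_mul, Pi.zero_apply]

theorem integrableOn_Ioo_primitive {g : ℝ → ℝ} (hg : Integrable g) :
    IntegrableOn (fun x => ∫ t in Iio x, g t) (Ioo 0 1) := by
  have hc : Continuous fun x => ∫ t in Iio x, g t := by
    have e : (fun x => ∫ t in Iio x, g t) =
        fun x => (∫ t in Iic (0 : ℝ), g t) + ∫ t in (0 : ℝ)..x, g t := by
      funext x
      rw [← intervalIntegral.integral_Iic_sub_Iic hg.integrableOn hg.integrableOn,
        integral_Iic_eq_integral_Iio (x := x)]
      ring
    rw [e]
    exact continuous_const.add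
      (intervalIntegral.continuous_primitive (fun a b => hg.intervalIntegrable) 0)
  exact hc.integrableOn_Icc.mono_set Ioo_subset_Icc_self

/-- As the functions in `rightTest` need not vanish at `0`, every `χ ∈ C_c^∞(0,1)` is the derivative
`ψ'` of one of them, `ψ = -∫_x^1 χ`. Hence there is no undetermined additive constant. -/
theorem ae_eq_primitive_of_rightTest {v : ℝ → ℝ} (hv : IntegrableOn v (Ioo 0 1)) {g : ℝ → ℝ}
    (hg : Integrable g) (hg0 : ∀ t ≤ 0, g t = 0)
    (h : ∀ ψ ∈ rightTest, ∫ x in Ioo (0 : ℝ) 1, v x * deriv ψ x =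
      -∫ x in Ioo (0 : ℝ) 1, g x * ψ x) :
    ∀ᵐ x, x ∈ Ioo (0 : ℝ) 1 → v x = ∫ t in Iio x, g t := by
  have hp := integrableOn_Ioo_primitive hg
  have key := ae_eq_zero_of_setIntegral_mul_test (f := fun x => v x - ∫ t in Iio x, g t)
    (hv.sub hp) fun χ h1 h2 h3 => by
      have hχ := mem_rightTest_of_tsupport_subset h1 h3
      have hd : ∀ x, HasDerivAt (fun x => ∫ t in (1 : ℝ)..x, χ t) (χ x) x := fun x =>
        intervalIntegral.integral_hasDerivAt_right (h1.continuous.intervalIntegrable _ _)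
          (h1.continuous.stronglyMeasurableAtFilter _ _) h1.continuous.continuousAt
      have hde : deriv (fun x => ∫ t in (1 : ℝ)..x, χ t) = χ := funext fun x => (hd x).deriv
      have hψ : (fun x => ∫ t in (1 : ℝ)..x, χ t) ∈ rightTest := by
        refine ⟨contDiff_one_iff_deriv.2 ⟨fun x => (hd x).differentiableAt, ?_⟩, fun x hx => ?_⟩
        · rw [hde]
          exact h1.continuous
        · refine intervalIntegral.integral_zero_ae (Eventually.of_forall fun t ht => hχ.2 t ?_)
          rw [uIoc_of_le hx] at ht
          exact ht.1.le
      have e := (h _ hψ).trans (setIntegral_primitive_mul_deriv hg hg0 hψ).symm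
      rw [hde] at e
      simp only [sub_mul]
      rw [integral_sub (integrableOn_Ioo_mul_continuous hv h1.continuous)
        (integrableOn_Ioo_mul_continuous hp h1.continuous), e, sub_self]
  filter_upwards [key] with x hx hx'
  exact sub_eq_zero.1 (hx hx')

/-! ### Duality -/

theorem abs_integral_mul_le {X : Type*} [MeasurableSpace X] {μ : Measure X} {f g : X → ℝ}
    (hf : MemLp f 2 μ) (hg : MemLp g 2 μ) :
    |∫ x, f x * g x ∂μ| ≤ (eLpNorm f 2 μ).toReal * (eLpNorm g 2 μ).toReal := by
  have e : ∫ x, f x * g x ∂μ = inner ℝ (hf.toLp f) (hg.toLp g) := by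
    rw [L2.inner_def]
    refine integral_congr_ae ?_
    filter_upwards [hf.coeFn_toLp, hg.coeFn_toLp] with x h1 h2
    rw [h1, h2]
    simp [mul_comm]
  rw [e]
  refine (abs_real_inner_le_norm _ _).trans (le_of_eq ?_)
  rw [Lp.norm_toLp, Lp.norm_toLp]

theorem inner_L2D_toLp (g : L2D) {ψ : ℝ → ℝ} (hψ : MemLp ψ 2 volD) :
    inner ℝ g (hψ.toLp ψ) = ∫ x in Ioo (0 : ℝ) 1, g x * ψ x := by
  rw [L2.inner_def]
  refine integral_congr_ae ?_
  filter_upwards [hψ.coeFn_toLp] with x h1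
  rw [h1]
  simp [mul_comm]

/-- The restriction to `(0,1)` of the functions in `rightTest`, as elements of `L²(D)`. -/
def rightTestToL2 : rightTest →ₗ[ℝ] L2D where
  toFun ψ := (memLp_volD_of_continuous ψ.2.1.continuous).toLp ψ
  map_add' _ _ := MemLp.toLp_add _ _
  map_smul' _ _ := MemLp.toLp_const_smul _ _

theorem denseRange_rightTestToL2 : DenseRange rightTestToL2 := by
  have h : (LinearMap.range rightTestToL2).topologicalClosure = ⊤ := by
    rw [Submodule.topologicalClosure_eq_top_iff, Submodule.eq_bot_iff]
    intro g hg
    rw [Submodule.mem_orthogonal'] at hg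
    have key := ae_eq_zero_of_setIntegral_mul_test (integrableOn_L2D g) fun ψ h1 h2 h3 => by
      have hψ := mem_rightTest_of_tsupport_subset h1 h3
      rw [← inner_L2D_toLp g (memLp_volD_of_continuous h1.continuous)]
      exact hg _ ⟨⟨ψ, hψ⟩, rfl⟩
    rw [Lp.eq_zero_iff_ae_eq_zero]
    exact (ae_restrict_iff' measurableSet_Ioo).2 key
  have h2 := (Submodule.dense_iff_topologicalClosure_eq_top).2 h
  exact h2

/-- If the distributional derivative of `v`, tested against `rightTest`, is bounded in `L²(D)`,
then `v` is the primitive, vanishing at `0`, of a function in `L²(D)`. -/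
theorem exists_primitive_of_bounded {v : ℝ → ℝ} (hv : IntegrableOn v (Ioo 0 1)) {C : ℝ}
    (hC : 0 ≤ C) (h : ∀ ψ ∈ rightTest, |∫ x in Ioo (0 : ℝ) 1, v x * deriv ψ x| ≤
      C * (eLpNorm ψ 2 volD).toReal) :
    ∃ g : L2D, ‖g‖ ≤ C ∧ ∀ᵐ x, x ∈ Ioo (0 : ℝ) 1 → v x = ∫ t in Iio x, zeroExt g t := by
  have hdc : ∀ ψ : rightTest, Continuous (deriv ψ.1) := fun ψ => ψ.2.1.continuous_deriv le_rfl
  have hdd : ∀ (ψ : rightTest) (x : ℝ), DifferentiableAt ℝ ψ.1 x := fun ψ x =>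
    (ψ.2.1.differentiable one_ne_zero).differentiableAt
  let Λ : rightTest →ₗ[ℝ] ℝ :=
    { toFun := fun ψ => -∫ x in Ioo (0 : ℝ) 1, v x * deriv ψ.1 x
      map_add' := by
        intro ψ φ
        rw [← neg_add, ← integral_add (integrableOn_Ioo_mul_continuous hv (hdc ψ))
          (integrableOn_Ioo_mul_continuous hv (hdc φ))]
        congr 1
        refine integral_congr_ae (Eventually.of_forall fun x => ?_)
        dsimp only
        rw [← mul_add, ← deriv_add (hdd ψ x) (hdd φ x)]
        rfl
      map_smul' := by
        intro c ψ
        rw [RingHom.id_apply, smul_eq_mul, mul_neg, ← integral_const_mul]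
        congr 1
        refine integral_congr_ae (Eventually.of_forall fun x => ?_)
        dsimp only
        have : deriv ((c • ψ : rightTest) : ℝ → ℝ) x = c * deriv ψ.1 x :=
          deriv_const_mul c (hdd ψ x)
        rw [this]
        ring }
  have hb : ∀ ψ, ‖Λ ψ‖ ≤ C * ‖rightTestToL2 ψ‖ := by
    intro ψ
    have e : ‖rightTestToL2 ψ‖ = (eLpNorm ψ.1 2 volD).toReal :=
      Lp.norm_toLp _ (memLp_volD_of_continuous ψ.2.1.continuous)
    rw [e, Real.norm_eq_abs]
    simp only [Λ, LinearMap.coe_mk, AddHom.coe_mk, abs_neg]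
    exact h ψ.1 ψ.2
  let L := Λ.extendOfNorm rightTestToL2
  have hL : ∀ ψ, L (rightTestToL2 ψ) = Λ ψ :=
    LinearMap.extendOfNorm_eq denseRange_rightTestToL2 ⟨C, hb⟩
  let g : L2D := (InnerProductSpace.toDual ℝ L2D).symm L
  have hg : ∀ ψ : rightTest, ∫ x in Ioo (0 : ℝ) 1, g x * ψ.1 x = Λ ψ := by
    intro ψ
    rw [← inner_L2D_toLp g (memLp_volD_of_continuous ψ.2.1.continuous), ← hL ψ]
    exact InnerProductSpace.toDual_symm_apply
  refine ⟨g, ?_, ae_eq_primitive_of_rightTest hv (integrable_zeroExt g) (zeroExt_of_nonpos _) ?_⟩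
  · rw [LinearIsometryEquiv.norm_map]
    exact LinearMap.opNorm_extendOfNorm_le denseRange_rightTestToL2 hC hb
  · intro ψ hψ
    have e : ∫ x in Ioo (0 : ℝ) 1, zeroExt g x * ψ x = ∫ x in Ioo (0 : ℝ) 1, g x * ψ x :=
      setIntegral_congr_fun measurableSet_Ioo fun x hx => by rw [zeroExt_of_mem hx]
    rw [e, hg ⟨ψ, hψ⟩]
    simp [Λ]

/-! ### Riemann-Liouville integrals of square integrable functions -/

/-- The kernel is causal: the values at `x ≤ 1` depend only on the function on `(-∞,1)`. -/
theorem conv_unitKernel_congr {f f' : ℝ → ℝ} (h : ∀ᵐ t, t < 1 → f t = f' t) {x : ℝ} (hx : x ≤ 1)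
    (a : ℝ) : conv f (unitKernel a) x = conv f' (unitKernel a) x := by
  rw [conv_apply, conv_apply]
  refine integral_congr_ae ?_
  filter_upwards [h] with t ht
  by_cases h1 : t < x
  · rw [ht (h1.trans_le hx)]
  · rw [unitKernel, indicator_of_notMem fun hm => h1 (by linarith [hm.1]), mul_zero, mul_zero]

theorem memLp_two_of_lintegral_le {X : Type*} [MeasurableSpace X] {μ : Measure X} {f : X → ℝ}
    (hf : AEStronglyMeasurable f μ) {M : ℝ} (hM : 0 ≤ M)
    (h : ∫⁻ x, ‖f x‖ₑ ^ 2 ∂μ ≤ ENNReal.ofReal M) :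
    MemLp f 2 μ ∧ (eLpNorm f 2 μ).toReal ^ 2 ≤ M := by
  rw [← eLpNorm_two_sq] at h
  have hlt := h.trans_lt ENNReal.ofReal_lt_top
  refine ⟨⟨hf, ?_⟩, ?_⟩
  · by_contra hn
    rw [not_lt_top_iff] at hn
    simp [hn] at hlt
  · rw [← ENNReal.toReal_pow]
    exact ENNReal.toReal_le_of_le_ofReal hM h

theorem diffQuot_congr {s : ℝ} {J : Set ℝ} {f g : ℝ → ℝ} (h : f =ᵐ[volume.restrict J] g) :
    diffQuot s f =ᵐ[(volume.restrict J).prod (volume.restrict J)] diffQuot s g := by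
  have h1 := Measure.quasiMeasurePreserving_fst (μ := volume.restrict J)
    (ν := volume.restrict J) |>.ae_eq_comp h
  have h2 := Measure.quasiMeasurePreserving_snd (μ := volume.restrict J)
    (ν := volume.restrict J) |>.ae_eq_comp h
  filter_upwards [h1, h2] with p hp1 hp2
  simp only [Function.comp_apply] at hp1 hp2
  simp only [diffQuot, hp1, hp2]

theorem normHs_congr {s : ℝ} {J : Set ℝ} {f g : ℝ → ℝ} (h : f =ᵐ[volume.restrict J] g) :
    normHs s J f = normHs s J g := by
  rw [normHs, normHs, eLpNorm_congr_ae h, eLpNorm_congr_ae (diffQuot_congr h)]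

theorem zeroExt_ae_eq_conv {s : ℝ} {u g : L2D} (h : u =ᵐ[volD] conv (zeroExt g) (unitKernel s)) :
    ∀ᵐ x, x < 1 → zeroExt u x = conv (zeroExt g) (unitKernel s) x := by
  filter_upwards [(ae_restrict_iff' measurableSet_Ioo).1 h] with x hx hx1
  by_cases h0 : 0 < x
  · rw [zeroExt_of_mem ⟨h0, hx1⟩, hx ⟨h0, hx1⟩]
  · rw [zeroExt_of_nonpos _ _ (not_lt.1 h0),
      conv_unitKernel_of_nonpos (zeroExt_of_nonpos _) (not_lt.1 h0)]

/-- Boundedness of the Riemann-Liouville integral of order `s` from `L²(D)` to `HtildeL s`. -/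
theorem exists_normHtildeL_le {s : ℝ} (hs : 1 / 2 < s) (hs1 : s < 1) :
    ∃ C : ℝ, 0 < C ∧ ∀ u g : L2D, u =ᵐ[volD] conv (zeroExt g) (unitKernel s) →
      u ∈ HtildeL s ∧ normHtildeL s u ≤ C * ‖g‖ := by
  obtain ⟨C, hC, hCle⟩ := lintegral_lintegral_conv_rlKernelDiff_le (s := s) (by linarith) hs1
  have hk := memLp_unitKernel hs
  set κ := (eLpNorm (unitKernel s) 2 volume).toReal
  refine ⟨Real.sqrt (κ ^ 2 + 2 * C), by positivity, fun u g hu => ?_⟩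
  set P := conv (zeroExt g) (unitKernel s) with hP
  have hPc : Continuous P := continuous_conv (memLp_zeroExt g) hk
  have hPb : ∀ x, |P x| ≤ κ * ‖g‖ := by
    intro x
    refine (abs_conv_le (memLp_zeroExt g) hk x).trans (le_of_eq ?_)
    rw [eLpNorm_zeroExt, toReal_enorm]
  have hcongr : P =ᵐ[volume.restrict (Iio 1)] zeroExt u := by
    refine (ae_restrict_iff' measurableSet_Iio).2 ?_
    filter_upwards [zeroExt_ae_eq_conv hu] with x hx hx1
    exact (hx hx1).symm
  obtain ⟨m1, n1⟩ := memLp_two_of_lintegral_le (μ := volume.restrict (Iio (1 : ℝ))) (f := P)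
    hPc.aestronglyMeasurable (M := (κ * ‖g‖) ^ 2) (by positivity) (by
      calc ∫⁻ x in Iio 1, ‖P x‖ₑ ^ 2
          ≤ ∫⁻ x in Iio 1, (Ioo (0 : ℝ) 1).indicator
              (fun _ => ENNReal.ofReal ((κ * ‖g‖) ^ 2)) x := by
            refine setLIntegral_mono' measurableSet_Iio fun x hx => ?_
            by_cases h0 : 0 < x
            · rw [indicator_of_mem (mem_Ioo.2 ⟨h0, hx⟩), enorm_sq_eq_ofReal, ← sq_abs]
              exact ENNReal.ofReal_le_ofReal (pow_le_pow_left₀ (abs_nonneg _) (hPb x) 2)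
            · rw [hP, conv_unitKernel_of_nonpos (zeroExt_of_nonpos _) (not_lt.1 h0)]
              simp
        _ = _ := by
            rw [lintegral_indicator measurableSet_Ioo, Measure.restrict_restrict measurableSet_Ioo,
              inter_eq_left.2 Ioo_subset_Iio_self, lintegral_const]
            simp)
  have hGL : ∫⁻ x, ‖zeroExt g x‖ₑ ^ 2 = ENNReal.ofReal (‖g‖ ^ 2) := by
    rw [← eLpNorm_two_sq, eLpNorm_zeroExt, ← ofReal_norm, ENNReal.ofReal_pow (norm_nonneg _)]
  obtain ⟨m2, n2⟩ := memLp_two_of_lintegral_le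
    (μ := (volume.restrict (Iio (1 : ℝ))).prod (volume.restrict (Iio (1 : ℝ))))
    (f := diffQuot s P) (measurable_diffQuot hPc.measurable).aestronglyMeasurable
    (M := 2 * C * ‖g‖ ^ 2) (mul_nonneg (by linarith) (sq_nonneg _)) (by
      refine (lintegral_diffQuot_Iio_le s hPc.measurable
        (d := fun h x => conv (zeroExt g) (rlKernelDiff s h) x) fun h hh x hx => ?_).trans ?_
      · exact conv_unitKernel_sub (zeroExt_of_nonpos _) hx.le hh
          (integrable_conv_integrand (memLp_zeroExt g) hk x)
          (integrable_conv_integrand (memLp_zeroExt g) hk (x - h))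
      · refine (mul_le_mul_right (hCle _ (integrable_zeroExt g)) 2).trans (le_of_eq ?_)
        rw [hGL, ← ENNReal.ofReal_mul hC.le, mul_assoc,
          ENNReal.ofReal_mul (p := 2) (by norm_num), ENNReal.ofReal_ofNat])
  refine ⟨MemHs.congr ⟨m1, m2⟩ hcongr, ?_⟩
  rw [normHtildeL, ← normHs_congr hcongr, normHs, ← Real.sqrt_sq (norm_nonneg g),
    ← Real.sqrt_mul (by positivity)]
  refine Real.sqrt_le_sqrt ?_
  calc _ ≤ (κ * ‖g‖) ^ 2 + 2 * C * ‖g‖ ^ 2 := add_le_add n1 n2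
    _ = _ := by ring

theorem isRLDeriv_of_ae_eq_conv {s : ℝ} (hs0 : 0 < s) (hs1 : s < 1) {u g : L2D}
    (hu : u =ᵐ[volD] conv (zeroExt g) (unitKernel s)) : IsRLDeriv s u g := by
  have hG := integrable_zeroExt g
  have key : ∀ᵐ x, x ∈ Ioo (0 : ℝ) 1 → rlIntegral (1 - s) u x = ∫ t in Iio x, zeroExt g t := by
    filter_upwards [ae_conv_conv_unitKernel hs0 (b := 1 - s) (by linarith) (by ring) hG
      (zeroExt_of_nonpos _)] with x hx hx'
    rw [rlIntegral_eq_conv ⟨hx'.1, hx'.2.le⟩,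
      conv_unitKernel_congr (zeroExt_ae_eq_conv hu) hx'.2.le, hx hx'.2.le]
  have key' := (ae_restrict_iff' (μ := volume) measurableSet_Ioo).2 key
  refine ⟨?_, (integrableOn_L2D g).locallyIntegrableOn, fun ψ h1 h2 h3 => ?_⟩
  · have : IntegrableOn (rlIntegral (1 - s) u) (Ioo 0 1) :=
      (integrableOn_Ioo_primitive hG).congr (EventuallyEq.symm key')
    exact this.locallyIntegrableOn
  · have e := setIntegral_primitive_mul_deriv hG (zeroExt_of_nonpos _)
      (mem_rightTest_of_tsupport_subset h1 h3)
    have e2 : ∫ x in Ioo (0 : ℝ) 1, zeroExt g x * ψ x = ∫ x in Ioo (0 : ℝ) 1, g x * ψ x :=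
      setIntegral_congr_fun measurableSet_Ioo fun x hx => by rw [zeroExt_of_mem hx]
    rw [← e2, ← e]
    refine integral_congr_ae ?_
    filter_upwards [key'] with x hx
    rw [hx]

/-! ### Functions with finite Gagliardo energy are Riemann-Liouville integrals -/

theorem integrable_mul_of_rightTest {v θ : ℝ → ℝ} (hv : Integrable v) (hv0 : ∀ x ≤ 0, v x = 0)
    (hθ : Continuous θ) (hθ1 : ∀ x, 1 ≤ x → θ x = 0) :
    Integrable (fun x => v x * θ x) ∧ ∫ x, v x * θ x = ∫ x in Ioo (0 : ℝ) 1, v x * θ x := by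
  have e : (fun x => v x * θ x) = (Ioo (0 : ℝ) 1).indicator fun x => v x * θ x := by
    funext x
    by_cases hx : x ∈ Ioo (0 : ℝ) 1
    · rw [indicator_of_mem hx]
    · rw [indicator_of_notMem hx]
      rcases le_or_gt x 0 with h | h
      · rw [hv0 x h, zero_mul]
      · rw [hθ1 x (not_lt.1 fun h1 => hx ⟨h, h1⟩), mul_zero]
  refine ⟨?_, ?_⟩
  · rw [e, integrable_indicator_iff measurableSet_Ioo]
    exact integrableOn_Ioo_mul_continuous hv.integrableOn hθ
  · conv_lhs => rw [e]
    rw [integral_indicator measurableSet_Ioo]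

/-- If the backward difference quotients of `v` agree on `(0,1)` with functions bounded in `L²`,
then so is the derivative of `v` in the sense of distributions. -/
theorem abs_setIntegral_mul_deriv_le {v : ℝ → ℝ} (hv : Integrable v) (hv0 : ∀ x ≤ 0, v x = 0)
    {w : ℝ → ℝ → ℝ} {C : ℝ} (hC : 0 ≤ C)
    (hvw : ∀ h, 0 < h → ∀ᵐ x, x < 1 → v x - v (x - h) = w h x)
    (hwm : ∀ h, 0 < h → AEStronglyMeasurable (w h))
    (hw : ∀ h, 0 < h → ∫⁻ x, ‖w h x‖ₑ ^ 2 ≤ ENNReal.ofReal ((C * h) ^ 2))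
    {ψ : ℝ → ℝ} (hψ : ψ ∈ rightTest) :
    |∫ x in Ioo (0 : ℝ) 1, v x * deriv ψ x| ≤ C * (eLpNorm ψ 2 volD).toReal := by
  have hψc := hψ.1.continuous
  have hdiff : Differentiable ℝ ψ := hψ.1.differentiable one_ne_zero
  have hψD := memLp_volD_of_continuous hψc
  have bound : ∀ h, 0 < h → |∫ x in Ioo (0 : ℝ) 1, v x * (h⁻¹ * (ψ (x + h) - ψ x))| ≤
      C * (eLpNorm ψ 2 volD).toReal := by
    intro h hh
    obtain ⟨i1, e1⟩ := integrable_mul_of_rightTest hv hv0 hψc hψ.2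
    obtain ⟨i2, e2⟩ := integrable_mul_of_rightTest hv hv0
      (θ := fun x => ψ (x + h)) (by fun_prop) (fun x hx => hψ.2 _ (by linarith))
    obtain ⟨i3, e3⟩ := integrable_mul_of_rightTest (hv.comp_sub_right h)
      (fun x hx => hv0 _ (by linarith)) hψc hψ.2
    -- Move the difference quotient from `ψ` to `v`. No boundary term arises at `0`, as `v` and its
    -- translate to the right both vanish on `(-∞,0]`.
    have e4 : ∫ x, v x * ψ (x + h) = ∫ x, v (x - h) * ψ x := by
      rw [← integral_sub_right_eq_self (fun x => v x * ψ (x + h)) h]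
      simp
    have e5 : ∫ x in Ioo (0 : ℝ) 1, v x * (h⁻¹ * (ψ (x + h) - ψ x)) =
        -(h⁻¹ * ∫ x in Ioo (0 : ℝ) 1, w h x * ψ x) := by
      calc _ = ∫ x in Ioo (0 : ℝ) 1, h⁻¹ * (v x * ψ (x + h) - v x * ψ x) := by
            congr 1
            funext x
            ring
        _ = h⁻¹ * ((∫ x in Ioo (0 : ℝ) 1, v (x - h) * ψ x) -
              ∫ x in Ioo (0 : ℝ) 1, v x * ψ x) := by
            rw [integral_const_mul, integral_sub i2.integrableOn i1.integrableOn, ← e2, e4, e3]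
        _ = -(h⁻¹ * ∫ x in Ioo (0 : ℝ) 1, (v x - v (x - h)) * ψ x) := by
            simp only [sub_mul]
            rw [integral_sub i1.integrableOn i3.integrableOn]
            ring
        _ = _ := by
            congr 2
            refine integral_congr_ae ((ae_restrict_iff' measurableSet_Ioo).2 ?_)
            filter_upwards [hvw h hh] with x hx hx'
            rw [hx hx'.2]
    have hle : ∫⁻ x in Ioo 0 1, ‖w h x‖ₑ ^ 2 ≤ ENNReal.ofReal ((C * h) ^ 2) :=
      (setLIntegral_le_lintegral _ _).trans (hw h hh)
    obtain ⟨m, n⟩ := memLp_two_of_lintegral_le (hwm h hh).restrict (sq_nonneg _) hle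
    have hn : (eLpNorm (w h) 2 volD).toReal ≤ C * h :=
      le_of_sq_le_sq n (by positivity)
    rw [e5, abs_neg, abs_mul, abs_of_pos (inv_pos.2 hh)]
    calc h⁻¹ * |∫ x in Ioo (0 : ℝ) 1, w h x * ψ x|
        ≤ h⁻¹ * ((C * h) * (eLpNorm ψ 2 volD).toReal) := by
          gcongr
          exact (abs_integral_mul_le m hψD).trans (by gcongr)
      _ = C * (eLpNorm ψ 2 volD).toReal := by field_simp
  have lim : Tendsto (fun h => ∫ x in Ioo (0 : ℝ) 1, v x * (h⁻¹ * (ψ (x + h) - ψ x))) (𝓝[>] 0)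
      (𝓝 (∫ x in Ioo (0 : ℝ) 1, v x * deriv ψ x)) := by
    obtain ⟨M, hM0, hM⟩ := exists_abs_le_of_continuous (hψ.1.continuous_deriv le_rfl) 0 2
    refine tendsto_integral_filter_of_dominated_convergence (fun x => |v x| * M) ?_ ?_ ?_ ?_
    · refine Eventually.of_forall fun h => ?_
      exact hv.aestronglyMeasurable.restrict.mul (Continuous.aestronglyMeasurable (by fun_prop))
    · filter_upwards [Ioo_mem_nhdsGT (zero_lt_one (α := ℝ))] with h hh
      filter_upwards [ae_restrict_mem measurableSet_Ioo] with x hx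
      have h0 : 0 < h := hh.1
      rw [norm_mul, norm_mul, Real.norm_eq_abs, norm_inv, Real.norm_eq_abs h, abs_of_pos h0]
      gcongr
      have := Convex.norm_image_sub_le_of_norm_deriv_le (f := ψ) (s := Icc 0 2) (C := M)
        (x := x) (y := x + h) (fun y _ => hdiff.differentiableAt) (fun y hy => hM y hy)
        (convex_Icc 0 2) ⟨hx.1.le, by linarith [hx.2]⟩
        ⟨by linarith [hx.1], by linarith [hx.2, hh.2]⟩
      rw [add_sub_cancel_left, Real.norm_eq_abs h, abs_of_pos h0] at this
      rw [inv_mul_le_iff₀ h0]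
      linarith
    · exact (hv.abs.mul_const M).integrableOn
    · refine Eventually.of_forall fun x => ?_
      exact ((hdiff x).hasDerivAt.tendsto_slope_zero_right).const_mul (v x)
  exact le_of_tendsto lim.abs (eventually_mem_nhdsWithin.mono bound)

/-- The Gagliardo seminorm of order `s` on `(-∞,1)`. -/
def gagliardoIio (s : ℝ) (f : ℝ → ℝ) : ℝ :=
  (eLpNorm (diffQuot s f) 2 ((volume.restrict (Iio (1 : ℝ))).prod
    (volume.restrict (Iio (1 : ℝ))))).toReal

theorem integrable_reflectOne_zeroExt (φ : L2D) : Integrable (reflectOne (zeroExt φ)) := by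
  have hm := measurable_reflectOne (measurable_zeroExt φ)
  have h2 : MemLp (reflectOne (zeroExt φ)) 2 := by
    have hφ : ∫⁻ x in Iio 1, ‖zeroExt φ x‖ₑ ^ 2 ≤ ENNReal.ofReal (‖φ‖ ^ 2) := by
      refine (setLIntegral_le_lintegral _ _).trans (le_of_eq ?_)
      rw [← eLpNorm_two_sq, eLpNorm_zeroExt, ← ofReal_norm, ENNReal.ofReal_pow (norm_nonneg _)]
    refine (memLp_two_of_lintegral_le hm.aestronglyMeasurable (M := 2 * ‖φ‖ ^ 2)
      (by positivity) ?_).1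
    rw [lintegral_reflectOne_sq (measurable_zeroExt φ), ENNReal.ofReal_mul (by norm_num)]
    norm_num
    gcongr
    simpa using hφ
  have e : reflectOne (zeroExt φ) = (Icc (0 : ℝ) 2).indicator (reflectOne (zeroExt φ)) := by
    funext x
    by_cases hx : x ∈ Icc (0 : ℝ) 2
    · rw [indicator_of_mem hx]
    · rw [indicator_of_notMem hx]
      refine zeroExt_of_nonpos _ _ ?_
      by_cases h0 : 0 ≤ x
      · exact (min_le_right _ _).trans (by linarith [lt_of_not_ge fun h => hx ⟨h0, h⟩])
      · exact (min_le_left _ _).trans (not_le.1 h0).le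
  rw [e, integrable_indicator_iff measurableSet_Icc]
  exact (h2.restrict (Icc (0 : ℝ) 2)).integrable (by norm_num)

/-- The integral of order `1 - s` of `φ ∈ HtildeL s` is a primitive `∫_0^x g` with `g ∈ L²(D)`. The
reflected function is used because Plancherel's theorem needs a function on the whole line; on
`(0,1)` the two have the same integral of order `1 - s`. -/
theorem exists_primitive_of_mem_HtildeL {s : ℝ} (hs0 : 0 < s) (hs1 : s < 1) :
    ∃ C : ℝ, 0 < C ∧ ∀ φ ∈ HtildeL s, ∃ g : L2D, ‖g‖ ≤ C * gagliardoIio s (zeroExt φ) ∧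
      ∀ᵐ x, x ∈ Ioo (0 : ℝ) 1 → conv (reflectOne (zeroExt φ)) (unitKernel (1 - s)) x =
        ∫ t in Iio x, zeroExt g t := by
  obtain ⟨C, hC, hCle⟩ := lintegral_conv_rlKernelDiff_one_sub_le hs0 hs1
  refine ⟨2 * Real.sqrt C, by positivity, fun φ hφ => ?_⟩
  have hm := measurable_zeroExt φ
  set F := reflectOne (zeroExt φ) with hF
  have hFm : Measurable F := measurable_reflectOne hm
  have hFi : Integrable F := integrable_reflectOne_zeroExt φ
  have hF0 : ∀ t ≤ 0, F t = 0 := fun t ht =>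
    zeroExt_of_nonpos _ _ ((min_le_left _ _).trans ht)
  have hki := integrable_unitKernel (a := 1 - s) (by linarith)
  set v := conv F (unitKernel (1 - s)) with hv
  have hvi : Integrable v := hFi.integrable_convolution _ hki
  have hv0 : ∀ x ≤ 0, v x = 0 := fun x hx => conv_unitKernel_of_nonpos hF0 hx _
  set X := gagliardoIio s (zeroExt φ) with hX
  have hX0 : 0 ≤ X := ENNReal.toReal_nonneg
  have hE : ∫⁻ p, ‖diffQuot s (zeroExt φ) p‖ₑ ^ 2 ∂((volume.restrict (Iio (1 : ℝ))).prod
      (volume.restrict (Iio (1 : ℝ)))) = ENNReal.ofReal (X ^ 2) := by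
    rw [← eLpNorm_two_sq, ENNReal.ofReal_pow hX0, hX, gagliardoIio,
      ENNReal.ofReal_toReal hφ.2.eLpNorm_ne_top]
  have hI : ∫⁻ r in Ioi 0, ENNReal.ofReal (r ^ (-1 - 2 * s)) * ∫⁻ x, ‖F x - F (x - r)‖ₑ ^ 2 ≤
      4 * ENNReal.ofReal (X ^ 2) := by
    rw [← hE]
    refine le_trans ?_ (lintegral_diffQuot_reflectOne_le hs0 hm)
    rw [lintegral_diffQuot_univ s hFm]
    exact le_mul_of_one_le_left zero_le (by norm_num)
  have hb : 0 ≤ 2 * Real.sqrt C * X := by positivity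
  refine exists_primitive_of_bounded hvi.integrableOn hb fun ψ hψ => ?_
  refine abs_setIntegral_mul_deriv_le hvi hv0 hb (w := fun h => conv F (rlKernelDiff (1 - s) h))
    (fun h hh => ?_) (fun h hh => ?_) (fun h hh => ?_) hψ
  · have h1 := hFi.ae_convolution_exists (ContinuousLinearMap.mul ℝ ℝ) hki
    have h2 := (measurePreserving_sub_right volume h).quasiMeasurePreserving.ae h1
    filter_upwards [h1, h2] with x hx1 hx2 hx
    exact conv_unitKernel_sub hF0 hx.le hh hx1 hx2
  · exact (hFi.integrable_convolution _
      (integrable_rlKernelDiff (by linarith) (by linarith) hh)).aestronglyMeasurable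
  · refine (hCle F hFi h hh).trans ((mul_le_mul_right hI _).trans (le_of_eq ?_))
    rw [show (4 : ℝ≥0∞) = ENNReal.ofReal 4 by norm_num, ← ENNReal.ofReal_mul (by norm_num),
      ← ENNReal.ofReal_mul (by positivity)]
    congr 1
    rw [mul_pow, mul_pow, mul_pow, Real.sq_sqrt hC.le]
    ring

/-- Every function in `HtildeL s` is the Riemann-Liouville integral of order `s` of a function in
`L²(D)`. Its integral of order `1 - s` is a primitive `∫_0^x g`, as is that of the integral of
order `s` of `g`; applying the integral of order `s` once more identifies the two functions. -/
theorem exists_eq_conv_of_mem_HtildeL {s : ℝ} (hs0 : 0 < s) (hs1 : s < 1) :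
    ∃ C : ℝ, 0 < C ∧ ∀ φ ∈ HtildeL s, ∃ g : L2D, ‖g‖ ≤ C * normHtildeL s φ ∧
      φ =ᵐ[volD] conv (zeroExt g) (unitKernel s) := by
  obtain ⟨C, hC, hCle⟩ := exists_primitive_of_mem_HtildeL hs0 hs1
  refine ⟨C, hC, fun φ hφ => ?_⟩
  obtain ⟨g, hg, hgv⟩ := hCle φ hφ
  have hle : gagliardoIio s (zeroExt φ) ≤ normHtildeL s φ :=
    Real.le_sqrt_of_sq_le (le_add_of_nonneg_left (sq_nonneg _))
  refine ⟨g, hg.trans (by gcongr), ?_⟩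
  set F := reflectOne (zeroExt φ) with hF
  have hFi : Integrable F := integrable_reflectOne_zeroExt φ
  have hF0 : ∀ t ≤ 0, F t = 0 := fun t ht =>
    zeroExt_of_nonpos _ _ ((min_le_left _ _).trans ht)
  have hGi := integrable_zeroExt g
  have hki := integrable_unitKernel (a := 1 - s) (by linarith)
  set P := conv (zeroExt g) (unitKernel s) with hP
  have hPi : Integrable P := hGi.integrable_convolution _ (integrable_unitKernel hs0)
  have hP0 : ∀ t ≤ 0, P t = 0 := fun t ht =>
    conv_unitKernel_of_nonpos (zeroExt_of_nonpos _) ht _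
  have he0 : ∀ t ≤ 0, (F - P) t = 0 := fun t ht => by simp [hF0 t ht, hP0 t ht]
  have hz : ∀ᵐ x, x < 1 → conv (F - P) (unitKernel (1 - s)) x = 0 := by
    filter_upwards [hgv, ae_conv_conv_unitKernel hs0 (b := 1 - s) (by linarith) (by ring) hGi
      (zeroExt_of_nonpos _), hFi.ae_convolution_exists (ContinuousLinearMap.mul ℝ ℝ) hki,
      hPi.ae_convolution_exists (ContinuousLinearMap.mul ℝ ℝ) hki] with x h1 h2 h3 h4 hx
    rcases le_or_gt x 0 with h0 | h0
    · exact conv_unitKernel_of_nonpos he0 h0 _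
    · have e : conv (F - P) (unitKernel (1 - s)) x =
          conv F (unitKernel (1 - s)) x - conv P (unitKernel (1 - s)) x := by
        rw [conv_apply]
        simp only [Pi.sub_apply, sub_mul]
        exact integral_sub h3 h4
      rw [e, h1 ⟨h0, hx⟩, h2 hx.le, sub_self]
  -- Applying the integral of order `s` to `hz` gives a vanishing primitive of `F - P`.
  have key := ae_eq_zero_of_ae_primitive_eq_zero (hFi.sub hPi) he0 (by
    filter_upwards [ae_conv_conv_unitKernel (a := 1 - s) (by linarith) hs0 (by ring)
      (hFi.sub hPi) he0] with x hx hx'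
    rw [← hx hx'.2.le, conv_unitKernel_congr (f' := 0) hz hx'.2.le, conv_apply]
    simp)
  refine (ae_restrict_iff' measurableSet_Ioo).2 ?_
  filter_upwards [key] with x hx hx'
  have h1 : F x = φ x := by
    rw [hF, reflectOne, min_eq_left (by linarith [hx'.2]), zeroExt_of_mem hx']
  rw [← h1]
  exact sub_eq_zero.1 (hx hx')

/-! ### The space `U` -/

theorem exists_ae_eq_conv {s : ℝ} (hs : 1 / 2 < s) (g : L2D) :
    ∃ u : L2D, u =ᵐ[volD] conv (zeroExt g) (unitKernel s) :=
  have h := memLp_volD_of_continuous (continuous_conv (memLp_zeroExt g) (memLp_unitKernel hs))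
  ⟨h.toLp _, h.coeFn_toLp⟩

theorem conv_zeroExt_add {s : ℝ} (hs : 1 / 2 < s) (g g' : L2D) :
    conv (zeroExt ⇑(g + g')) (unitKernel s) =
      conv (zeroExt g) (unitKernel s) + conv (zeroExt g') (unitKernel s) := by
  funext x
  have hk := memLp_unitKernel hs
  have h := zeroExt_congr (Lp.coeFn_add g g') univ
  rw [Measure.restrict_univ] at h
  rw [Pi.add_apply, conv_apply, conv_apply, conv_apply,
    ← integral_add (integrable_conv_integrand (memLp_zeroExt g) hk x)
      (integrable_conv_integrand (memLp_zeroExt g') hk x)]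
  refine integral_congr_ae ?_
  filter_upwards [h] with t ht
  have e : zeroExt (⇑g + ⇑g') t = zeroExt g t + zeroExt g' t :=
    congrFun (indicator_add' _ _ _) t
  rw [ht, e, add_mul]

theorem conv_zeroExt_smul (s c : ℝ) (g : L2D) :
    conv (zeroExt ⇑(c • g)) (unitKernel s) = c • conv (zeroExt g) (unitKernel s) := by
  funext x
  have h := zeroExt_congr (Lp.coeFn_smul c g) univ
  rw [Measure.restrict_univ] at h
  rw [Pi.smul_apply, conv_apply, conv_apply, smul_eq_mul, ← integral_const_mul]
  refine integral_congr_ae ?_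
  filter_upwards [h] with t ht
  have e : zeroExt (c • ⇑g) t = c * zeroExt g t := congrFun (indicator_const_smul _ c ⇑g) t
  rw [ht, e, mul_assoc]

/-- The Riemann-Liouville integral of order `s > 1/2` of a square integrable function is continuous
at `0`, so it is not a nonzero multiple of `x^(s-1)`. -/
theorem eq_zero_of_rpow_ae_eq_conv {s : ℝ} (hs : 1 / 2 < s) (hs1 : s < 1) {c : ℝ} {g : L2D}
    (h : (fun x => c * x ^ (s - 1)) =ᵐ[volD] conv (zeroExt g) (unitKernel s)) : c = 0 := by
  have hc := continuous_conv (memLp_zeroExt g) (memLp_unitKernel hs)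
  have heq := Measure.eqOn_Ioo_of_ae_eq volume h (continuousOn_const.mul fun x hx =>
    (Real.continuousAt_rpow_const x _ (Or.inl hx.1.ne')).continuousWithinAt) hc.continuousOn
  have hlim : Tendsto (fun x => conv (zeroExt g) (unitKernel s) x * x ^ (1 - s)) (𝓝[>] 0)
      (𝓝 0) := by
    have hcont : ContinuousAt (fun x => conv (zeroExt g) (unitKernel s) x * x ^ (1 - s)) 0 :=
      hc.continuousAt.mul (Real.continuousAt_rpow_const 0 _ (Or.inr (by linarith)))
    have := hcont.tendsto
    rw [Real.zero_rpow (by linarith), mul_zero] at this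
    exact this.mono_left nhdsWithin_le_nhds
  refine tendsto_nhds_unique (f := fun _ : ℝ => c) tendsto_const_nhds (hlim.congr' ?_)
  filter_upwards [Ioo_mem_nhdsGT (zero_lt_one (α := ℝ))] with x hx
  rw [← heq hx]
  dsimp only
  rw [mul_assoc, ← Real.rpow_add hx.1]
  simp

theorem HasValueAtOne.unique {u : ℝ → ℝ} {c d : ℝ} (hc : HasValueAtOne u c)
    (hd : HasValueAtOne u d) : c = d := by
  obtain ⟨f, hf, hfu, rfl⟩ := hc
  obtain ⟨g, hg, hgu, rfl⟩ := hd
  have h : f =ᵐ[volume.restrict (Ioc (0 : ℝ) 1)] g := by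
    rw [← restrict_Ioo_eq_restrict_Ioc]
    exact hfu.trans hgu.symm
  exact Measure.eqOn_Ioc_of_ae_eq volume h hf hg ⟨one_pos, le_rfl⟩

theorem rlDeriv_eq {β : ℝ} {u g : L2D} (h : IsRLDeriv β u g) : rlDeriv β u = g := by
  have hex : ∃ g, IsRLDeriv β u g := ⟨g, h⟩
  rw [rlDeriv, dif_pos hex]
  exact hex.choose_spec.unique h

theorem rlDeriv_eq_of_ae_eq_conv {s : ℝ} (hs : 1 / 2 < s) (hs1 : s < 1) {u g : L2D}
    (h : u =ᵐ[volD] conv (zeroExt g) (unitKernel s)) : rlDeriv s u = g :=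
  rlDeriv_eq (isRLDeriv_of_ae_eq_conv (by linarith) hs1 h)

/-- A function in `HtildeL s` is the Riemann-Liouville integral of its derivative. -/
theorem ae_eq_conv_rlDeriv {s : ℝ} (hs : 1 / 2 < s) (hs1 : s < 1) {u : L2D} (hu : u ∈ HtildeL s) :
    u =ᵐ[volD] conv (zeroExt (rlDeriv s u)) (unitKernel s) := by
  obtain ⟨_, -, h⟩ := exists_eq_conv_of_mem_HtildeL (s := s) (by linarith) hs1
  obtain ⟨g, -, hg⟩ := h u hu
  rwa [rlDeriv_eq_of_ae_eq_conv hs hs1 hg]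

theorem rlDeriv_add {s : ℝ} (hs : 1 / 2 < s) (hs1 : s < 1) {u v : L2D} (hu : u ∈ HtildeL s)
    (hv : v ∈ HtildeL s) : rlDeriv s (u + v) = rlDeriv s u + rlDeriv s v := by
  refine rlDeriv_eq_of_ae_eq_conv hs hs1 ?_
  rw [conv_zeroExt_add hs]
  exact (Lp.coeFn_add u v).trans
    ((ae_eq_conv_rlDeriv hs hs1 hu).add (ae_eq_conv_rlDeriv hs hs1 hv))

theorem rlDeriv_smul {s : ℝ} (hs : 1 / 2 < s) (hs1 : s < 1) (c : ℝ) {u : L2D}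
    (hu : u ∈ HtildeL s) : rlDeriv s (c • u) = c • rlDeriv s u := by
  refine rlDeriv_eq_of_ae_eq_conv hs hs1 ?_
  rw [conv_zeroExt_smul]
  exact (Lp.coeFn_smul c u).trans ((ae_eq_conv_rlDeriv hs hs1 hu).const_smul c)

theorem IsRegularPart.unique {α : ℝ} (hα : 3 / 2 < α) (hα2 : α < 2) {u u₀ u₁ : L2D}
    (h₀ : IsRegularPart α u u₀) (h₁ : IsRegularPart α u u₁) : u₀ = u₁ := by
  obtain ⟨hu₀, c, -, hc⟩ := h₀
  obtain ⟨hu₁, d, -, hd⟩ := h₁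
  have hdiff : ∀ᵐ x ∂volD, (u₀ - u₁) x = (c - d) * x ^ (α - 1 - 1) := by
    filter_upwards [hc, hd, Lp.coeFn_sub u₀ u₁] with x e1 e2 e3
    rw [e3, Pi.sub_apply, show α - 1 - 1 = α - 2 by ring]
    linarith
  -- The difference of two regular parts is a multiple of `x^(α-2)` that lies in `HtildeL (α-1)`.
  have hcd : c - d = 0 := eq_zero_of_rpow_ae_eq_conv (s := α - 1) (by linarith) (by linarith)
    ((EventuallyEq.symm hdiff).trans
      (ae_eq_conv_rlDeriv (by linarith) (by linarith) (sub_mem hu₀ hu₁)))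
  rw [← sub_eq_zero, Lp.eq_zero_iff_ae_eq_zero]
  filter_upwards [hdiff] with x hx
  rw [hx, hcd, zero_mul, Pi.zero_apply]

theorem SpaceU.isRegularPart {α : ℝ} (u : SpaceU α) : IsRegularPart α u.toL2 u.regularPart :=
  (exists_isRegularPart u).choose_spec

theorem SpaceU.regularPart_eq {α : ℝ} (hα : 3 / 2 < α) (hα2 : α < 2) {u : SpaceU α} {u₀ : L2D}
    (h : IsRegularPart α u.toL2 u₀) : u.regularPart = u₀ :=
  u.isRegularPart.unique hα hα2 h

theorem SpaceU.regularPart_add {α : ℝ} (hα : 3 / 2 < α) (hα2 : α < 2) (u v : SpaceU α) :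
    (u + v).regularPart = u.regularPart + v.regularPart := by
  refine SpaceU.regularPart_eq hα hα2 ?_
  obtain ⟨hu, c, ⟨f, hf, hfu, hf1⟩, hc⟩ := u.isRegularPart
  obtain ⟨hv, d, ⟨g, hg, hgv, hg1⟩, hd⟩ := v.isRegularPart
  refine ⟨add_mem hu hv, c + d, ⟨f + g, hf.add hg,
    (hfu.add hgv).trans (Lp.coeFn_add _ _).symm, by simp [hf1, hg1]⟩, ?_⟩
  have e : (u + v).toL2 = u.toL2 + v.toL2 := rfl
  rw [e]
  filter_upwards [hc, hd, Lp.coeFn_add u.toL2 v.toL2, Lp.coeFn_add u.regularPart v.regularPart]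
    with x e1 e2 e3 e4
  rw [e3, e4, Pi.add_apply, Pi.add_apply, e1, e2]
  ring

theorem SpaceU.regularPart_smul {α : ℝ} (hα : 3 / 2 < α) (hα2 : α < 2) (a : ℝ) (u : SpaceU α) :
    (a • u).regularPart = a • u.regularPart := by
  refine SpaceU.regularPart_eq hα hα2 ?_
  obtain ⟨hu, c, ⟨f, hf, hfu, hf1⟩, hc⟩ := u.isRegularPart
  refine ⟨Submodule.smul_mem _ a hu, a * c, ⟨a • f, hf.const_smul a,
    (hfu.const_smul a).trans (Lp.coeFn_smul _ _).symm, by simp [hf1]⟩, ?_⟩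
  have e : (a • u).toL2 = a • u.toL2 := rfl
  rw [e]
  filter_upwards [hc, Lp.coeFn_smul a u.toL2, Lp.coeFn_smul a u.regularPart] with x e1 e3 e4
  rw [e3, e4, Pi.smul_apply, Pi.smul_apply, e1, smul_eq_mul, smul_eq_mul]
  ring

/-- The map `u ↦ D^(α-1) u₀` from `U` to `L²(D)`, whose `L²` norm is the norm of `U`. -/
def SpaceU.derivMap {α : ℝ} (hα : 3 / 2 < α) (hα2 : α < 2) : SpaceU α →ₗ[ℝ] L2D where
  toFun u := rlDeriv (α - 1) u.regularPart
  map_add' u v := by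
    rw [SpaceU.regularPart_add hα hα2,
      rlDeriv_add (by linarith) (by linarith) u.isRegularPart.1 v.isRegularPart.1]
  map_smul' a u := by
    rw [SpaceU.regularPart_smul hα hα2,
      rlDeriv_smul (by linarith) (by linarith) a u.isRegularPart.1, RingHom.id_apply]

theorem SpaceU.eq_zero_of_derivMap_eq_zero {α : ℝ} (hα : 3 / 2 < α) (hα2 : α < 2) {u : SpaceU α}
    (h : SpaceU.derivMap hα hα2 u = 0) : u = 0 := by
  obtain ⟨hu, c, hc1, hc⟩ := u.isRegularPart
  have h0 : rlDeriv (α - 1) u.regularPart = (0 : ℝ) • (0 : L2D) := by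
    rw [zero_smul]
    exact h
  have h1 := ae_eq_conv_rlDeriv (by linarith) (by linarith) hu
  rw [h0, conv_zeroExt_smul, zero_smul] at h1
  have hc0 : c = 0 := hc1.unique ⟨0, continuousOn_const, h1.symm, rfl⟩
  have h2 : u.toL2 = 0 := by
    rw [Lp.eq_zero_iff_ae_eq_zero]
    filter_upwards [hc, h1] with x e1 e2
    rw [e1, e2, hc0]
    simp
  exact Subtype.ext h2

/-- The preimage of `g` is `f - f(1) x^(α-2)`, where `f` is the integral of order `α - 1` of `g`. -/
theorem SpaceU.derivMap_surjective {α : ℝ} (hα : 3 / 2 < α) (hα2 : α < 2) :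
    Function.Surjective (SpaceU.derivMap hα hα2) := by
  intro g
  have hs : 1 / 2 < α - 1 := by linarith
  have hs1 : α - 1 < 1 := by linarith
  obtain ⟨w, hw⟩ := exists_ae_eq_conv hs g
  obtain ⟨_, -, hle⟩ := exists_normHtildeL_le hs hs1
  have hwH := (hle w g hw).1
  set f := conv (zeroExt g) (unitKernel (α - 1))
  have hf : Continuous f := continuous_conv (memLp_zeroExt g) (memLp_unitKernel hs)
  have hpow : MemLp (fun x : ℝ => x ^ (α - 2)) 2 volD := by
    have hG := (Real.Gamma_pos_of_pos (show 0 < α - 1 by linarith)).ne'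
    refine MemLp.ae_eq ?_ (((memLp_unitKernel hs).restrict (Ioo 0 1)).const_mul
      (Real.Gamma (α - 1)))
    refine (ae_restrict_iff' measurableSet_Ioo).2 (Eventually.of_forall fun x hx => ?_)
    dsimp only
    rw [unitKernel, indicator_of_mem hx, mul_div_cancel₀ _ hG, show α - 1 - 1 = α - 2 by ring]
  set p : L2D := hpow.toLp _
  have hu : (w - f 1 • p : L2D) =ᵐ[volD] fun x => w x - f 1 * x ^ (α - 2) := by
    filter_upwards [Lp.coeFn_sub w (f 1 • p), Lp.coeFn_smul (f 1) p, hpow.coeFn_toLp]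
      with x e1 e2 e3
    rw [e1, Pi.sub_apply, e2, Pi.smul_apply, e3, smul_eq_mul]
  have hmem : w - f 1 • p ∈ submoduleU α := by
    refine ⟨⟨w, hwH, -f 1, ?_⟩, fun x => f x - f 1 * x ^ (α - 2), ?_, ?_, by simp⟩
    · filter_upwards [hu] with x hx
      rw [hx]
      ring
    · exact hf.continuousOn.sub (continuousOn_const.mul fun x hx =>
        (Real.continuousAt_rpow_const x _ (Or.inl hx.1.ne')).continuousWithinAt)
    · filter_upwards [hu, hw] with x e1 e2
      rw [e1, e2]
  let U : SpaceU α := ⟨w - f 1 • p, hmem⟩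
  have hreg : U.regularPart = w :=
    SpaceU.regularPart_eq hα hα2 ⟨hwH, f 1, ⟨f, hf.continuousOn, hw.symm, rfl⟩, hu⟩
  refine ⟨U, ?_⟩
  change rlDeriv (α - 1) U.regularPart = g
  rw [hreg]
  exact rlDeriv_eq_of_ae_eq_conv hs hs1 hw

theorem SpaceU.normCore {α : ℝ} (hα : 3 / 2 < α) (hα2 : α < 2) :
    NormedSpace.Core ℝ (SpaceU α) where
  norm_nonneg u := norm_nonneg (SpaceU.derivMap hα hα2 u)
  norm_smul c u := by
    change ‖SpaceU.derivMap hα hα2 (c • u)‖ = ‖c‖ * ‖SpaceU.derivMap hα hα2 u‖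
    rw [map_smul, norm_smul]
  norm_triangle u v := by
    change ‖SpaceU.derivMap hα hα2 (u + v)‖ ≤
      ‖SpaceU.derivMap hα hα2 u‖ + ‖SpaceU.derivMap hα hα2 v‖
    rw [map_add]
    exact norm_add_le _ _
  norm_eq_zero_iff u := by
    change ‖SpaceU.derivMap hα hα2 u‖ = 0 ↔ u = 0
    rw [norm_eq_zero]
    exact ⟨SpaceU.eq_zero_of_derivMap_eq_zero hα hα2, fun h => by rw [h, map_zero]⟩

/-- `U` is isometric to `L²(D)`. -/
theorem SpaceU.completeSpace {α : ℝ} (hα : 3 / 2 < α) (hα2 : α < 2) :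
    letI : NormedAddCommGroup (SpaceU α) := NormedAddCommGroup.ofCore (SpaceU.normCore hα hα2)
    CompleteSpace (SpaceU α) := by
  let : NormedAddCommGroup (SpaceU α) := NormedAddCommGroup.ofCore (SpaceU.normCore hα hα2)
  have hiso : Isometry (SpaceU.derivMap hα hα2) :=
    AddMonoidHomClass.isometry_of_norm _ fun _ => rfl
  rw [completeSpace_iff_isComplete_range hiso.isUniformInducing,
    (SpaceU.derivMap_surjective hα hα2).range_eq]
  exact isComplete_univ

end

end FracMixed

/-- For `3/2 < α < 2`: the representation `u = u₀ - u₀(1) x^(α-2)` of the elements of `U` is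
unique, the derivative of order `α - 1` exists in `L²(D)` and is unique on `HtildeL (α-1)`, its
`L²(D)` norm is equivalent to the norm of `HtildeL (α-1)`, and `U` with
`‖u‖_U = ‖D^(α-1) u₀‖` is a normed space which is complete. -/
theorem lemma5p1 (α : ℝ) (hα : 3 / 2 < α) (hα2 : α < 2) :
    (∀ u : FracMixed.SpaceU α, ∃! u₀ : FracMixed.L2D, FracMixed.IsRegularPart α u.toL2 u₀) ∧
    (∀ φ ∈ FracMixed.HtildeL (α - 1), ∃! g : FracMixed.L2D, FracMixed.IsRLDeriv (α - 1) φ g) ∧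
    (∃ c C : ℝ, 0 < c ∧ 0 < C ∧ ∀ φ ∈ FracMixed.HtildeL (α - 1),
      c * FracMixed.normHtildeL (α - 1) φ ≤ ‖FracMixed.rlDeriv (α - 1) φ‖ ∧
        ‖FracMixed.rlDeriv (α - 1) φ‖ ≤ C * FracMixed.normHtildeL (α - 1) φ) ∧
    ∃ core : NormedSpace.Core ℝ (FracMixed.SpaceU α),
      letI : NormedAddCommGroup (FracMixed.SpaceU α) := NormedAddCommGroup.ofCore core
      CompleteSpace (FracMixed.SpaceU α) := by
  have hs : 1 / 2 < α - 1 := by linarith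
  have hs1 : α - 1 < 1 := by linarith
  refine ⟨fun u => ⟨u.regularPart, u.isRegularPart, fun u₀ h =>
    h.unique hα hα2 u.isRegularPart⟩, fun φ hφ => ?_, ?_,
    FracMixed.SpaceU.normCore hα hα2, FracMixed.SpaceU.completeSpace hα hα2⟩
  · have h := FracMixed.isRLDeriv_of_ae_eq_conv (by linarith) hs1
      (FracMixed.ae_eq_conv_rlDeriv hs hs1 hφ)
    exact ⟨_, h, fun g hg => hg.unique h⟩
  · obtain ⟨A, hA, hAle⟩ := FracMixed.exists_normHtildeL_le hs hs1
    obtain ⟨C, hC, hCle⟩ := FracMixed.exists_eq_conv_of_mem_HtildeL (s := α - 1) (by linarith) hs1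
    refine ⟨A⁻¹, C, inv_pos.2 hA, hC, fun φ hφ => ⟨?_, ?_⟩⟩
    · rw [inv_mul_le_iff₀ hA]
      exact (hAle φ _ (FracMixed.ae_eq_conv_rlDeriv hs hs1 hφ)).2
    · obtain ⟨g, hg, hφg⟩ := hCle φ hφ
      rwa [FracMixed.rlDeriv_eq_of_ae_eq_conv hs hs1 hφg]
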